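/- **Setting.** Let $Y$ be a complex manifold of dimension $n+1$ and $\rho:Y\to\mathbb R$ a smooth function such that $\overline X=\{\rho\le 0\}$ is compact, $d\rho\ne 0$ on $M=\{\rho=0\}$, and $M=\partial X$, $X=\{\rho<0\}$, is strictly pseudoconvex, i.e. $\partial\bar\partial\rho(V,\overline V)>0$ for $0\ne V\in T^{1,0}Y|_M$ with $\partial\rho(V)=0$. Let $g$ be a Hermitian metric on $X$ with $g=\partial\bar\partial\log(-1/\rho)$ near $M$. Put $\vartheta=\frac{\sqrt{-1}}2(\bar\partial\rho-\partial\rho)$. Latin indices run over $0,\dots,n$, Greek ones over $1,\dots,n$, and repeated indices are summed. Near $M$ there are a unique $(1,0)$-vector field $\xi$ and a unique real function $r$ (the transverse curvature) with $\rho_i\xi^i=1$ and $\rho_{i\bar j}\xi^{\bar j}=r\rho_i$; both are smooth. An *admissible frame* on an open set is a local $(1,0)$-frame $W_0=\xi, W_1,\dots,W_n$ with $W_1,\dots,W_n$ spanning $\operatorname{Ker}\partial\rho$; its dual coframe is $\theta^0=\partial\rho,\theta^1,\dots,\theta^n$. Put $h_{\alpha\bar\beta}=\partial\bar\partial\rho(W_\alpha,\overline{W_\beta})$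 (positive definite near $M$), $r_\alpha=W_\alpha r$, $r^\alpha=h^{\alpha\bar\beta}r_{\bar\beta}$. The *Graham–Lee connection* $\nabla$ is the connection with $\nabla\xi=0$ whose connection forms, $\nabla W_\alpha=\varphi_\alpha{}^\beta\otimes W_\beta$, satisfy $$d\theta^\alpha=\theta^\beta\wedge\varphi_\beta{}^\alpha-\sqrt{-1}A^\alpha{}_{\bar\gamma}\,\partial\rho\wedge\theta^{\bar\gamma}-r^\alpha\,\partial\rho\wedge\bar\partial\rho+\tfrac12 r\,d\rho\wedge\theta^\alpha,\qquad dh_{\alpha\bar\beta}=\varphi_\alpha{}^\gamma h_{\gamma\bar\beta}+h_{\alpha\bar\gamma}\overline{\varphi_\beta{}^\gamma}.$$ On the level sets of $\rho$ the forms $\varphi_\beta{}^\alpha$ and the tensor $A$ restrict to the Tanaka–Webster connection forms and torsion of $\vartheta$. Put $A_{\beta\gamma}=h_{\beta\bar\alpha}\overline{A^\alpha{}_{\bar\gamma}}$. Let $\psi_i{}^j$ be the connection forms of $g$ in the frame $W_i$ and $\Psi_i{}^j=d\psi_i{}^j-\psi_i{}^k\wedge\psi_k{}^j$ its curvature forms.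 With $\rho_k=W_k\rho$, the renormalized connection and curvature forms are $$\theta_i{}^j=\psi_i{}^j-\tfrac1{-\rho}(\delta_i{}^j\rho_k+\delta_k{}^j\rho_i)\theta^k,\qquad W_i{}^j=\Psi_i{}^j+(\delta_i{}^jg_{k\bar l}+\delta_k{}^jg_{i\bar l})\theta^k\wedge\theta^{\bar l}.$$ **Proposition.** There is an open neighbourhood $V$ of $M$ in $Y$ on which $\xi$ and $r$ exist, are smooth and unique, and $1-r\rho>0$, such that for every admissible frame on an open subset $U\subset V$ contained in a holomorphic coordinate chart, $(h_{\alpha\bar\beta})$ is positive definite, smooth $\varphi_\beta{}^\alpha$ and $A^\alpha{}_{\bar\gamma}$ as above exist and are unique on $U$, and on $U\cap X$ $$\begin{aligned} \theta_\beta{}^\alpha&=\varphi_\beta{}^\alpha+\sqrt{-1}\,r\,\delta_\beta{}^\alpha\,\vartheta,\\ \theta_0{}^\alpha&=r\theta^\alpha-\sqrt{-1}A^\alpha{}_{\bar\gamma}\theta^{\bar\gamma}-r^\alpha\bar\partial\rho,\\ \theta_\beta{}^0&=-h_{\beta\bar\gamma}\theta^{\bar\gamma}+\frac{-\rho r_\beta}{1-r\rho}\partial\rho+\frac{\sqrt{-1}\rho}{1-r\rho}A_{\beta\gamma}\theta^\gamma,\\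 \theta_0{}^0&=-r\bar\partial\rho+\frac{-\rho r^2}{1-r\rho}\partial\rho+\frac{-\rho}{1-r\rho}\partial r, \end{aligned}$$ and $$W_i{}^j=\Theta_i{}^j-u_i\wedge\theta^j,\qquad \Theta_i{}^j=d\theta_i{}^j-\theta_i{}^k\wedge\theta_k{}^j,$$ where $$u_0=\frac{r^2}{1-r\rho}\partial\rho+\frac1{1-r\rho}\partial r,\qquad u_\beta=-\frac{\sqrt{-1}}{1-r\rho}A_{\beta\gamma}\theta^\gamma+\frac{r_\beta}{1-r\rho}\partial\rho.$$ In particular $\theta_i{}^j$, $\Theta_i{}^j$, $W_i{}^j$ and $u_i$ are continuous up to the boundary: they extend continuously to $U\cap\overline X$. -/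

import Mathlib

open scoped Manifold ContDiff ComplexConjugate ComplexOrder

noncomputable section

namespace BurnsEpstein

/-- The model space `ℂ^{n+1}`. A vector `V = (V^a)` is read both as the real tangent vector
`2 Re (V^a ∂/∂z^a)` (real and imaginary parts of the coordinates) and as the `(1,0)`-vector
`V^a ∂/∂z^a`. -/
abbrev Cn (n : ℕ) : Type := EuclideanSpace ℂ (Fin (n + 1))

/-- The value at a point of a complex valued 1-form (a form on real tangent vectors). A
`(1,0)`-form `η_a dz^a` is the complex linear form `v ↦ η_a v^a`. -/
abbrev OneCovector (n : ℕ) : Type := Cn n →L[ℝ] ℂ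

/-- The value at a point of a complex valued 2-form. -/
abbrev TwoCovector (n : ℕ) : Type := Cn n →L[ℝ] Cn n →L[ℝ] ℂ

variable {n : ℕ}

/-! ### Calculus of complex valued forms on open subsets of `ℂ^{n+1}` -/

/-- Multiplication by `i` on tangent vectors. -/
def mulI (n : ℕ) : Cn n →L[ℝ] Cn n :=
  (Complex.I • ContinuousLinearMap.id ℂ (Cn n)).restrictScalars ℝ

/-- `∂f = f_a dz^a`. -/
def del (f : Cn n → ℂ) (z : Cn n) : OneCovector n :=
  (1 / 2 : ℂ) • (fderiv ℝ f z - Complex.I • (fderiv ℝ f z).comp (mulI n))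

/-- `∂̄f = f_ā dz̄^a`. -/
def delbar (f : Cn n → ℂ) (z : Cn n) : OneCovector n :=
  (1 / 2 : ℂ) • (fderiv ℝ f z + Complex.I • (fderiv ℝ f z).comp (mulI n))

/-- `(∂∂̄f)(V, W̄) = f_{ab̄} V^a W̄^b`, where `f_{ab̄} = ∂²f / ∂z^a ∂z̄^b`. -/
def levi (f : Cn n → ℂ) (z V W : Cn n) : ℂ :=
  del (fun w => delbar f w W) z V

/-- The complex conjugate of a 1-form. -/
def conjForm (α : OneCovector n) : OneCovector n :=
  (Complex.conjCLE : ℂ →L[ℝ] ℂ).comp α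

/-- `(α ∧ β)(u, v) = α(u) β(v) - α(v) β(u)`. -/
def wedge (α β : OneCovector n) : TwoCovector n :=
  α.smulRight β - β.smulRight α

/-- Exterior derivative of a 1-form: `(dα)(u, v) = (D_u α)(v) - (D_v α)(u)`. -/
def extd (α : Cn n → OneCovector n) (z : Cn n) : TwoCovector n :=
  fderiv ℝ α z - (fderiv ℝ α z).flip

/-- The Kronecker delta. -/
def kron {ι : Type*} [DecidableEq ι] (i j : ι) : ℂ := if i = j then 1 else 0

/-- Coordinate vectors `∂/∂z^a`. -/
def coordVec (a : Fin (n + 1)) : Cn n := EuclideanSpace.single a 1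

/-- A real function, regarded as a complex valued one. -/
def toC (f : Cn n → ℝ) : Cn n → ℂ := fun z => (f z : ℂ)

/-- The contact form `θ = (i/2)(∂̄ρ - ∂ρ)`. -/
def contactForm (f : Cn n → ℝ) (z : Cn n) : OneCovector n :=
  (Complex.I / 2) • (delbar (toC f) z - del (toC f) z)

/-! ### Transverse curvature, admissible frames, Graham–Lee connection

Here `f` is the defining function read in a holomorphic chart, `U` is a set of the chart. -/

/-- The equations `ρ_a ξ^a = 1` and `ρ_{ab̄} ξ^b̄ = r ρ_a` at the point `z`. -/
def IsTransverseAt (f : Cn n → ℝ) (z ξ : Cn n) (r : ℝ) : Prop :=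
  del (toC f) z ξ = 1 ∧ ∀ V : Cn n, levi (toC f) z V ξ = r * del (toC f) z V

/-- `ξ` is the smooth `(1,0)`-field on `U` with `ρ_a ξ^a = 1`, `ρ_{ab̄} ξ^b̄ = r ρ_a`, and `r` is
the transverse curvature; both are uniquely determined at every point of `U`. -/
structure IsTransverse (f : Cn n → ℝ) (U : Set (Cn n)) (ξ : Cn n → Cn n) (r : Cn n → ℝ) :
    Prop where
  smooth_field : ContDiffOn ℝ ∞ ξ U
  smooth_curv : ContDiffOn ℝ ∞ r U
  eqns : ∀ z ∈ U, IsTransverseAt f z (ξ z) (r z)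
  unique : ∀ z ∈ U, ∀ (v : Cn n) (s : ℝ), IsTransverseAt f z v s → v = ξ z ∧ s = r z

/-- The full frame `W_0 = ξ, W_1, …, W_n`. -/
def fullFrame (ξ : Cn n → Cn n) (W : Fin n → Cn n → Cn n) : Fin (n + 1) → Cn n → Cn n :=
  Fin.cons ξ W

/-- `W_1, …, W_n` is a smooth frame of `Ker ∂ρ ⊂ T^{1,0}` over `U`, and `θ^0, …, θ^n` is the
`(1,0)`-coframe dual to `ξ, W_1, …, W_n` (so `θ^0 = ∂ρ`). -/
structure IsAdmissible (f : Cn n → ℝ) (U : Set (Cn n)) (ξ : Cn n → Cn n)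
    (W : Fin n → Cn n → Cn n) (θ : Fin (n + 1) → Cn n → OneCovector n) : Prop where
  smooth_frame : ∀ α, ContDiffOn ℝ ∞ (W α) U
  smooth_coframe : ∀ i, ContDiffOn ℝ ∞ (θ i) U
  ker : ∀ α, ∀ z ∈ U, del (toC f) z (W α z) = 0
  complex_linear : ∀ i, ∀ z ∈ U, ∀ v : Cn n, θ i z (Complex.I • v) = Complex.I * θ i z v
  dual : ∀ i j, ∀ z ∈ U, θ i z (fullFrame ξ W j z) = kron i j

/-- The Levi form `h_{αβ̄}` in the frame `W_α`. -/
def leviMatrix (f : Cn n → ℝ) (W : Fin n → Cn n → Cn n) (z : Cn n) : Matrix (Fin n) (Fin n) ℂ :=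
  fun α β => levi (toC f) z (W α z) (W β z)

/-- `r_α = W_α r`. -/
def lowerGrad (r : Cn n → ℝ) (W : Fin n → Cn n → Cn n) (α : Fin n) (z : Cn n) : ℂ :=
  del (toC r) z (W α z)

/-- `r^α = h^{αβ̄} r_β̄`, where `h^{αβ̄} h_{γβ̄} = δ^α_γ`. -/
def upperGrad (f r : Cn n → ℝ) (W : Fin n → Cn n → Cn n) (α : Fin n) (z : Cn n) : ℂ :=
  ∑ β, (leviMatrix f W z)⁻¹ β α * conj (lowerGrad r W β z)

/-- Lowering an index of the torsion: `A_{βγ} = h_{βᾱ} A^ᾱ_γ`, with `A^ᾱ_γ` the conjugate of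
`A^α_γ̄ = A α γ`. -/
def lowerTorsion (f : Cn n → ℝ) (W : Fin n → Cn n → Cn n) (A : Fin n → Fin n → Cn n → ℂ)
    (β γ : Fin n) (z : Cn n) : ℂ :=
  ∑ α, leviMatrix f W z β α * conj (A α γ z)

/-- `φ β α = φ_β^α` are the connection forms, and `A α γ = A^α_γ̄` is the torsion, of the
Graham–Lee connection in the admissible frame `W` with dual coframe `θ`. The connection is the one
with `∇ξ = 0` (that is `∇N = ∇T = 0`, where `ξ = N - (i/2) T`) and `∇W_α = φ_α^β ⊗ W_β`.

* `structure_eq` :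
  `dθ^α = θ^β ∧ φ_β^α - i A^α_γ̄ ∂ρ ∧ θ^γ̄ - r^α ∂ρ ∧ ∂̄ρ + (1/2) r dρ ∧ θ^α`;
* `metric` : `∇h = 0`, that is `dh_{αβ̄} = φ_α^γ h_{γβ̄} + h_{αγ̄} φ_β̄^γ̄`;
* `leaf` : on vectors tangent to the level sets of `ρ` the structure equation of the
  Tanaka–Webster connection of the contact form `θ` holds,
  `dθ^α = θ^β ∧ φ_β^α + A^α_γ̄ θ ∧ θ^γ̄`, so that `φ` and `A` restrict to the Tanaka–Webster
  connection forms and torsion of the level sets. -/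
structure IsGrahamLee (f : Cn n → ℝ) (U : Set (Cn n)) (r : Cn n → ℝ) (W : Fin n → Cn n → Cn n)
    (θ : Fin (n + 1) → Cn n → OneCovector n) (φ : Fin n → Fin n → Cn n → OneCovector n)
    (A : Fin n → Fin n → Cn n → ℂ) : Prop where
  smooth_forms : ∀ β α, ContDiffOn ℝ ∞ (φ β α) U
  smooth_torsion : ∀ α γ, ContDiffOn ℝ ∞ (A α γ) U
  structure_eq : ∀ α, ∀ z ∈ U,
    extd (θ α.succ) z =
      ∑ β : Fin n, wedge (θ β.succ z) (φ β α z)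
      - ∑ γ : Fin n, (Complex.I * A α γ z) •
          wedge (del (toC f) z) (conjForm (θ γ.succ z))
      - upperGrad f r W α z • wedge (del (toC f) z) (delbar (toC f) z)
      + ((1 / 2 : ℂ) * r z) • wedge (fderiv ℝ (toC f) z) (θ α.succ z)
  metric : ∀ α β, ∀ z ∈ U,
    fderiv ℝ (fun w => leviMatrix f W w α β) z =
      ∑ γ, leviMatrix f W z γ β • φ α γ z
      + ∑ γ, leviMatrix f W z α γ • conjForm (φ β γ z)
  leaf : ∀ α, ∀ z ∈ U, ∀ u v : Cn n, fderiv ℝ f z u = 0 → fderiv ℝ f z v = 0 →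
    extd (θ α.succ) z u v =
      (∑ β : Fin n, wedge (θ β.succ z) (φ β α z)
      + ∑ γ : Fin n, A α γ z • wedge (contactForm f z) (conjForm (θ γ.succ z))) u v

/-! ### Connection and curvature of a Hermitian metric, and their renormalizations

`G a b = g_{ab̄}` are the coefficients of the metric in the holomorphic coordinates, `F` is a frame
of `T^{1,0}` and `θ` the dual coframe. -/

/-- The Chern connection in the holomorphic coordinate frame: `Γ_a^b = (∂g_{ac̄}) g^{c̄b}`. -/
def chernCoord (G : Cn n → Matrix (Fin (n + 1)) (Fin (n + 1)) ℂ) (a b : Fin (n + 1)) (z : Cn n) :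
    OneCovector n :=
  ∑ c, (G z)⁻¹ c b • del (fun w => G w a c) z

/-- The connection forms in the frame `F`, defined by `∇F_i = ψ_i^j ⊗ F_j`:
`ψ_i^j(v) = θ^j(D_v F_i + F_i^a Γ_a^b(v) ∂_b)`. -/
def psi (G : Cn n → Matrix (Fin (n + 1)) (Fin (n + 1)) ℂ) (F : Fin (n + 1) → Cn n → Cn n)
    (θ : Fin (n + 1) → Cn n → OneCovector n) (i j : Fin (n + 1)) (z : Cn n) : OneCovector n :=
  (θ j z).comp (fderiv ℝ (F i) z)
  + ∑ a, ∑ b, (F i z a * θ j z (coordVec b)) • chernCoord G a b z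

/-- The curvature forms `dη_i^j - η_i^k ∧ η_k^j` of a matrix of connection forms. -/
def curv (η : Fin (n + 1) → Fin (n + 1) → Cn n → OneCovector n) (i j : Fin (n + 1)) (z : Cn n) :
    TwoCovector n :=
  extd (η i j) z - ∑ k, wedge (η i k z) (η k j z)

/-- `Y_i^j = (1/(-ρ)) (δ_i^j ρ_k + δ_k^j ρ_i) θ^k`, where `ρ_k = F_k ρ`. -/
def Yform (f : Cn n → ℝ) (F : Fin (n + 1) → Cn n → Cn n)
    (θ : Fin (n + 1) → Cn n → OneCovector n) (i j : Fin (n + 1)) (z : Cn n) : OneCovector n :=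
  (1 / (-(f z : ℂ))) • ∑ k,
    (kron i j * del (toC f) z (F k z) + kron k j * del (toC f) z (F i z)) • θ k z

/-- The renormalized connection forms `θ_i^j = ψ_i^j - Y_i^j`. -/
def renConn (f : Cn n → ℝ) (G : Cn n → Matrix (Fin (n + 1)) (Fin (n + 1)) ℂ)
    (F : Fin (n + 1) → Cn n → Cn n) (θ : Fin (n + 1) → Cn n → OneCovector n)
    (i j : Fin (n + 1)) (z : Cn n) : OneCovector n :=
  psi G F θ i j z - Yform f F θ i j z

/-- The components `g_{kl̄}` of the metric in the frame `F`. -/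
def frameMetric (G : Cn n → Matrix (Fin (n + 1)) (Fin (n + 1)) ℂ) (F : Fin (n + 1) → Cn n → Cn n)
    (k l : Fin (n + 1)) (z : Cn n) : ℂ :=
  ∑ a, ∑ b, G z a b * F k z a * conj (F l z b)

/-- `K_i^j = (δ_i^j g_{kl̄} + δ_k^j g_{il̄}) θ^k ∧ θ^l̄`. -/
def Kform (G : Cn n → Matrix (Fin (n + 1)) (Fin (n + 1)) ℂ) (F : Fin (n + 1) → Cn n → Cn n)
    (θ : Fin (n + 1) → Cn n → OneCovector n) (i j : Fin (n + 1)) (z : Cn n) : TwoCovector n :=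
  ∑ k, ∑ l, (kron i j * frameMetric G F k l z + kron k j * frameMetric G F i l z) •
    wedge (θ k z) (conjForm (θ l z))

/-- The renormalized curvature `W_i^j = Ψ_i^j + K_i^j`. -/
def renCurv (G : Cn n → Matrix (Fin (n + 1)) (Fin (n + 1)) ℂ) (F : Fin (n + 1) → Cn n → Cn n)
    (θ : Fin (n + 1) → Cn n → OneCovector n) (i j : Fin (n + 1)) (z : Cn n) : TwoCovector n :=
  curv (psi G F θ) i j z + Kform G F θ i j z

/-- The forms `u_0 = (r²/(1-rρ)) ∂ρ + (1/(1-rρ)) ∂r` and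
`u_β = -(i/(1-rρ)) A_{βγ} θ^γ + (r_β/(1-rρ)) ∂ρ`. -/
def uForm (f r : Cn n → ℝ) (W : Fin n → Cn n → Cn n) (θ : Fin (n + 1) → Cn n → OneCovector n)
    (A : Fin n → Fin n → Cn n → ℂ) (i : Fin (n + 1)) (z : Cn n) : OneCovector n :=
  Fin.cases
    (((r z : ℂ) ^ 2 / (1 - r z * f z)) • del (toC f) z
      + (1 / (1 - r z * f z : ℂ)) • del (toC r) z)
    (fun β : Fin n =>
      -(∑ γ : Fin n, (Complex.I / (1 - r z * f z : ℂ) * lowerTorsion f W A β γ z) • θ γ.succ z)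
      + (lowerGrad r W β z / (1 - r z * f z : ℂ)) • del (toC f) z) i

/-- The form `α`, given on `U ∩ {f < 0}`, is continuous up to the boundary: it extends
continuously to `U ∩ {f ≤ 0}`. -/
def ContinuousUpToBoundary {B : Type*} [TopologicalSpace B] (f : Cn n → ℝ) (U : Set (Cn n))
    (α : Cn n → B) : Prop :=
  ∃ β : Cn n → B, ContinuousOn β (U ∩ {z | f z ≤ 0}) ∧ ∀ z ∈ U, f z < 0 → β z = α z

/-! ### Defining functions and Hermitian metrics on complex manifolds -/

section Manifold

variable {Y : Type*} [TopologicalSpace Y] [ChartedSpace (Cn n) Y]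

/-- `ρ` is a smooth defining function of the relatively compact domain `X = {ρ < 0}` in the complex
manifold `Y` (a neighbourhood of the compact complex manifold with boundary `{ρ ≤ 0}`), with strictly
pseudoconvex boundary `M = {ρ = 0}`: the Levi form `-i dθ(V, V̄) = ρ_{ab̄} V^a V̄^b` of the contact
form `θ = (i/2)(∂̄ρ - ∂ρ)|_M` is positive on nonzero `V` in `T^{1,0}M = T^{1,0}Y ∩ Ker ∂ρ`. -/
structure IsStrictlyPseudoconvexDefiningFunction (ρ : Y → ℝ) : Prop where
  smooth : ContMDiff 𝓘(ℝ, Cn n) 𝓘(ℝ, ℝ) ∞ ρ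
  compact : IsCompact {x | ρ x ≤ 0}
  regular : ∀ e ∈ IsManifold.maximalAtlas 𝓘(ℂ, Cn n) ω Y, ∀ z ∈ e.target, ρ (e.symm z) = 0 →
    fderiv ℝ (ρ ∘ e.symm) z ≠ 0
  pseudoconvex : ∀ e ∈ IsManifold.maximalAtlas 𝓘(ℂ, Cn n) ω Y, ∀ z ∈ e.target,
    ρ (e.symm z) = 0 → ∀ V : Cn n, V ≠ 0 → del (toC (ρ ∘ e.symm)) z V = 0 →
      0 < (levi (toC (ρ ∘ e.symm)) z V V).re

/-- The coefficients `g_{ab̄}` in the chart `e` of a field of sesquilinear forms on the tangent spaces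
(complex linear in the first, antilinear in the second argument). -/
def metricCoeff
    (g : ∀ x : Y, TangentSpace 𝓘(ℂ, Cn n) x → TangentSpace 𝓘(ℂ, Cn n) x → ℂ)
    (e : OpenPartialHomeomorph Y (Cn n)) (z : Cn n) : Matrix (Fin (n + 1)) (Fin (n + 1)) ℂ :=
  fun a b => g (e.symm z)
    (mfderiv 𝓘(ℂ, Cn n) 𝓘(ℂ, Cn n) e.symm z (coordVec a : Cn n))
    (mfderiv 𝓘(ℂ, Cn n) 𝓘(ℂ, Cn n) e.symm z (coordVec b : Cn n))

/-- `g` is a smooth Hermitian metric on the open set `X` of `Y`. -/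
structure IsHermitianMetricOn
    (g : ∀ x : Y, TangentSpace 𝓘(ℂ, Cn n) x → TangentSpace 𝓘(ℂ, Cn n) x → ℂ)
    (X : Set Y) : Prop where
  add_left : ∀ x ∈ X, ∀ u v w : TangentSpace 𝓘(ℂ, Cn n) x, g x (u + v) w = g x u w + g x v w
  smul_left : ∀ x ∈ X, ∀ (c : ℂ) (u w : TangentSpace 𝓘(ℂ, Cn n) x), g x (c • u) w = c * g x u w
  symm : ∀ x ∈ X, ∀ u w : TangentSpace 𝓘(ℂ, Cn n) x, g x w u = conj (g x u w)
  pos : ∀ x ∈ X, ∀ u : TangentSpace 𝓘(ℂ, Cn n) x, u ≠ 0 → 0 < (g x u u).re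
  smooth : ∀ e ∈ IsManifold.maximalAtlas 𝓘(ℂ, Cn n) ω Y, ∀ a b,
    ContDiffOn ℝ ∞ (fun z => metricCoeff g e z a b) (e.target ∩ e.symm ⁻¹' X)

/-- `g = ∂∂̄ log(-1/ρ)` on the part of `X = {ρ < 0}` in a neighbourhood of `M = {ρ = 0}`. -/
def IsLogMetricNearBoundary (ρ : Y → ℝ)
    (g : ∀ x : Y, TangentSpace 𝓘(ℂ, Cn n) x → TangentSpace 𝓘(ℂ, Cn n) x → ℂ) : Prop :=
  ∃ N : Set Y, IsOpen N ∧ {x | ρ x = 0} ⊆ N ∧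
    ∀ e ∈ IsManifold.maximalAtlas 𝓘(ℂ, Cn n) ω Y, ∀ z ∈ e.target, e.symm z ∈ N →
      ρ (e.symm z) < 0 → ∀ a b : Fin (n + 1),
        metricCoeff g e z a b =
          levi (toC fun w => Real.log (-1 / ρ (e.symm w))) z (coordVec a) (coordVec b)

end Manifold

end BurnsEpstein

end

open BurnsEpstein

/-!
The Burns–Epstein renormalization of the connection of a complete Kähler metric
`g = ∂∂̄ log(-1/f)`, where `f` is a defining function read in a holomorphic chart.

Write `p = ∂f`, `L = ∂∂̄f`, `σ = -1/f`, so that `g = σ L + σ² p ⊗ p̄` (`levi_log`), and let `H`, `T`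
denote the derivatives `f_{ab}` and `f_{abc̄}` (`hessL`, `thirdL`). The Chern connection differs from
the flat connection of the chart by the tensor `X(v, u)` with `g(X(v, u), w) = (∂_v g)(u, w)`.
Differentiating the formula for `g`, the pole terms are exactly those of
`Y(v, u) = σ (p(v) u + p(u) v)`, and what remains is
`g(X - Y, w) = σ T(v, u; w) + σ² H(v, u) p̄(w)`. Testing with `w = ξ` and with the frame `W_β` of
`Ker ∂f`, this says `(1 - r f) p(C) = H(v, u) - f T(v, u; ξ)` and `L(C, W_β) = T(v, u; W_β)` for
`C = X - Y`. These equations have a smooth symmetric solution on both sides of the boundary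
(`cForm`), so the renormalized connection extends smoothly as the flat connection plus `C`
(`smoothConn`, `psi_eq`); symmetry of `C` makes it torsion free (`extd_coframe`).

The Graham–Lee connection is read off from the extension: `φ_β^α` is `θ_β^α - i r δ_β^α ϑ`, and the
torsion is `A^α_γ̄ = i θ^α(∂̄_{W_γ} ξ)`. All stated formulas follow by splitting the derivative of the
identity `L(ξ, w) = r p̄(w)` into types (`transverse_types`). Uniqueness is a type argument: the
structure equation fixes the torsion and the `(0,1)`-parts of `φ`, and the metric equation fixes the
`(1,0)`-parts (`isGrahamLee_unique`).

For the curvature, the singular terms of `dψ - ψ ∧ ψ` with `ψ = θ + Y` cancel against `K`, except for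
`-σ (θ_i^0 + L(W_i, ·)) ∧ θ^j`; the form `θ_i^0 + L(W_i, ·)` is the `(1,0)`-part of the last column,
which is `-f u_i` (`smoothConn_eq_uForm`, `renCurv_eq_smooth`).

The field `ξ` and the function `r` solve a linear system whose matrix is the Levi form bordered by
`∂f`. It is invertible wherever the Levi form is positive on `Ker ∂f ≠ T^{1,0}`, which is an open
condition independent of the holomorphic chart (`eventually_isGoodAt`, `isGoodAt_of_chart`).
-/

noncomputable section

namespace BurnsEpstein

variable {n : ℕ}

-- Norms on iterated spaces of continuous linear maps such as `Cn n →L[ℝ] Cn n →L[ℝ] Cn n →L[ℝ] ℂ`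
-- are not found at the default depth.
set_option maxSynthPendingDepth 6

/-! ### Types of real linear maps and of derivatives -/

section RealMaps

variable {B : Type*} [NormedAddCommGroup B] [NormedSpace ℝ B]

lemma real_map_I_I (M : Cn n →L[ℝ] B) (v : Cn n) :
    M (Complex.I • Complex.I • v) = -M v := by
  rw [smul_smul, Complex.I_mul_I, neg_one_smul, map_neg]

lemma contDiffAt_fderiv {q : Cn n → B} {z : Cn n} (h : ContDiffAt ℝ ∞ q z) :
    ContDiffAt ℝ ∞ (fderiv ℝ q) z := h.fderiv_right (by simp)

lemma differentiableAt_of_smooth {q : Cn n → B} {z : Cn n}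
    (h : ContDiffAt ℝ ∞ q z) : DifferentiableAt ℝ q z := h.differentiableAt (by simp)

lemma fderiv_clm_eval {q : Cn n → Cn n →L[ℝ] B} {z : Cn n} (h : DifferentiableAt ℝ q z)
    (v w : Cn n) : fderiv ℝ (fun y => q y w) z v = fderiv ℝ q z v w := by
  rw [(h.hasFDerivAt.clm_apply (hasFDerivAt_const w z)).fderiv]
  simp

lemma fderiv_fderiv_comm {q : Cn n → B} {z : Cn n} (h : ContDiffAt ℝ ∞ q z) (v w : Cn n) :
    fderiv ℝ (fderiv ℝ q) z v w = fderiv ℝ (fderiv ℝ q) z w v :=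
  (h.isSymmSndFDerivAt (by simpa using WithTop.coe_le_coe.2 (le_top : (2 : ℕ∞) ≤ ⊤))).eq v w

end RealMaps

section Parts

variable {B : Type*} [NormedAddCommGroup B] [NormedSpace ℝ B] [NormedSpace ℂ B]
  [IsScalarTower ℝ ℂ B]

@[simp] lemma mulI_apply (v : Cn n) : mulI n v = Complex.I • v := rfl

/-- The complex linear part of a real linear map. -/
def part10 (M : Cn n →L[ℝ] B) : Cn n →L[ℝ] B :=
  (1 / 2 : ℂ) • (M - Complex.I • M.comp (mulI n))

/-- The complex antilinear part of a real linear map. -/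
def part01 (M : Cn n →L[ℝ] B) : Cn n →L[ℝ] B :=
  (1 / 2 : ℂ) • (M + Complex.I • M.comp (mulI n))

/-- `∂q` for maps `q` with values in a complex Banach space. -/
def delG (q : Cn n → B) (z : Cn n) : Cn n →L[ℝ] B := part10 (fderiv ℝ q z)

/-- `∂̄q` for maps `q` with values in a complex Banach space. -/
def delbarG (q : Cn n → B) (z : Cn n) : Cn n →L[ℝ] B := part01 (fderiv ℝ q z)

lemma del_eq_delG (q : Cn n → ℂ) : del q = delG q := rfl

lemma delbar_eq_delbarG (q : Cn n → ℂ) : delbar q = delbarG q := rfl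

lemma part10_apply (M : Cn n →L[ℝ] B) (v : Cn n) :
    part10 M v = (1 / 2 : ℂ) • (M v - Complex.I • M (Complex.I • v)) := rfl

lemma part01_apply (M : Cn n →L[ℝ] B) (v : Cn n) :
    part01 M v = (1 / 2 : ℂ) • (M v + Complex.I • M (Complex.I • v)) := rfl

lemma part10_add_part01 (M : Cn n →L[ℝ] B) (v : Cn n) : part10 M v + part01 M v = M v := by
  rw [part10_apply, part01_apply]; module

lemma part10_I (M : Cn n →L[ℝ] B) (v : Cn n) :
    part10 M (Complex.I • v) = Complex.I • part10 M v := by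
  rw [part10_apply, part10_apply, real_map_I_I]
  rw [smul_comm Complex.I, smul_sub Complex.I, smul_smul Complex.I Complex.I, Complex.I_mul_I]
  module

lemma part01_I (M : Cn n →L[ℝ] B) (v : Cn n) :
    part01 M (Complex.I • v) = -(Complex.I • part01 M v) := by
  rw [part01_apply, part01_apply, real_map_I_I]
  rw [smul_comm Complex.I, smul_add Complex.I, smul_smul Complex.I Complex.I, Complex.I_mul_I]
  module

/-- A real linear map commuting with `i` is complex linear. -/
lemma map_smul_of_I {M : Cn n →L[ℝ] B} (h : ∀ v, M (Complex.I • v) = Complex.I • M v) (c : ℂ)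
    (v : Cn n) : M (c • v) = c • M v := by
  have hc : c = (c.re : ℂ) + c.im * Complex.I := (Complex.re_add_im c).symm
  have h1 : c • v = c.re • v + c.im • (Complex.I • v) := by
    conv_lhs => rw [hc]
    rw [add_smul, mul_smul, Complex.coe_smul, Complex.coe_smul]
  conv_rhs => rw [hc]
  rw [h1, map_add, map_smul, map_smul, h, add_smul, mul_smul]
  have e (t : ℝ) (x : B) : t • x = (t : ℂ) • x := by
    rw [← smul_one_smul ℂ t x, Complex.real_smul, mul_one]
  rw [e, e]

/-- A real linear map anticommuting with `i` is complex antilinear. -/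
lemma map_smul_of_neg_I {M : Cn n →L[ℝ] B} (h : ∀ v, M (Complex.I • v) = -(Complex.I • M v))
    (c : ℂ) (v : Cn n) : M (c • v) = conj c • M v := by
  have hc : c = (c.re : ℂ) + c.im * Complex.I := (Complex.re_add_im c).symm
  have h1 : c • v = c.re • v + c.im • (Complex.I • v) := by
    conv_lhs => rw [hc]
    rw [add_smul, mul_smul, Complex.coe_smul, Complex.coe_smul]
  conv_rhs => rw [hc]
  rw [h1, map_add, map_smul, map_smul, h]
  have e (t : ℝ) (x : B) : t • x = (t : ℂ) • x := by
    rw [← smul_one_smul ℂ t x, Complex.real_smul, mul_one]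
  rw [e, e, map_add, map_mul, Complex.conj_ofReal, Complex.conj_ofReal, Complex.conj_I]
  module

lemma part10_smul (M : Cn n →L[ℝ] B) (c : ℂ) (v : Cn n) : part10 M (c • v) = c • part10 M v :=
  map_smul_of_I (part10_I M) c v

lemma part01_smul (M : Cn n →L[ℝ] B) (c : ℂ) (v : Cn n) :
    part01 M (c • v) = conj c • part01 M v :=
  map_smul_of_neg_I (part01_I M) c v

lemma delG_smul (q : Cn n → B) (z : Cn n) (c : ℂ) (v : Cn n) :
    delG q z (c • v) = c • delG q z v := part10_smul _ c v

lemma delbarG_smul (q : Cn n → B) (z : Cn n) (c : ℂ) (v : Cn n) :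
    delbarG q z (c • v) = conj c • delbarG q z v := part01_smul _ c v

lemma delG_add_delbarG (q : Cn n → B) (z v : Cn n) :
    delG q z v + delbarG q z v = fderiv ℝ q z v := part10_add_part01 _ v

lemma contDiffAt_part10 {k : ℕ∞ω} {q : Cn n → Cn n →L[ℝ] B} {z : Cn n} (h : ContDiffAt ℝ k q z) :
    ContDiffAt ℝ k (fun y => part10 (q y)) z := by
  unfold part10
  exact (h.sub ((h.clm_comp contDiffAt_const).const_smul Complex.I)).const_smul (1 / 2 : ℂ)

lemma contDiffAt_part01 {k : ℕ∞ω} {q : Cn n → Cn n →L[ℝ] B} {z : Cn n} (h : ContDiffAt ℝ k q z) :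
    ContDiffAt ℝ k (fun y => part01 (q y)) z := by
  unfold part01
  exact (h.add ((h.clm_comp contDiffAt_const).const_smul Complex.I)).const_smul (1 / 2 : ℂ)

lemma contDiffAt_delG {q : Cn n → B} {z : Cn n} (h : ContDiffAt ℝ ∞ q z) :
    ContDiffAt ℝ ∞ (delG q) z := contDiffAt_part10 (contDiffAt_fderiv h)

lemma contDiffAt_delbarG {q : Cn n → B} {z : Cn n} (h : ContDiffAt ℝ ∞ q z) :
    ContDiffAt ℝ ∞ (delbarG q) z := contDiffAt_part01 (contDiffAt_fderiv h)

lemma delG_eval {q : Cn n → Cn n →L[ℝ] B} {z : Cn n} (h : DifferentiableAt ℝ q z)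
    (v w : Cn n) : delG (fun y => q y w) z v = delG q z v w := by
  simp only [delG, part10_apply, fderiv_clm_eval h]
  simp

lemma delbarG_eval {q : Cn n → Cn n →L[ℝ] B} {z : Cn n} (h : DifferentiableAt ℝ q z)
    (v w : Cn n) : delbarG (fun y => q y w) z v = delbarG q z v w := by
  simp only [delbarG, part01_apply, fderiv_clm_eval h]
  simp

lemma fderiv_part10 {q : Cn n → Cn n →L[ℝ] B} {z : Cn n} (h : DifferentiableAt ℝ q z)
    (v : Cn n) : fderiv ℝ (fun y => part10 (q y)) z v = part10 (fderiv ℝ q z v) := by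
  unfold part10
  have h1 := (h.hasFDerivAt.clm_comp (hasFDerivAt_const (mulI n) z)).const_smul Complex.I
  have h2 := (h.hasFDerivAt.sub h1).const_smul (1 / 2 : ℂ)
  refine (DFunLike.congr_fun h2.fderiv v).trans ?_
  ext w
  simp

lemma fderiv_part01 {q : Cn n → Cn n →L[ℝ] B} {z : Cn n} (h : DifferentiableAt ℝ q z)
    (v : Cn n) : fderiv ℝ (fun y => part01 (q y)) z v = part01 (fderiv ℝ q z v) := by
  unfold part01
  have h1 := (h.hasFDerivAt.clm_comp (hasFDerivAt_const (mulI n) z)).const_smul Complex.I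
  have h2 := (h.hasFDerivAt.add h1).const_smul (1 / 2 : ℂ)
  refine (DFunLike.congr_fun h2.fderiv v).trans ?_
  ext w
  simp

/-- `∂_v ∂_w q = ∂_w ∂_v q`. -/
lemma delG_delG_comm {q : Cn n → B} {z : Cn n} (h : ContDiffAt ℝ ∞ q z) (v w : Cn n) :
    delG (delG q) z v w = delG (delG q) z w v := by
  have hd := (differentiableAt_of_smooth (contDiffAt_fderiv h))
  have e (v : Cn n) : fderiv ℝ (delG q) z v = part10 (fderiv ℝ (fderiv ℝ q) z v) :=
    fderiv_part10 hd v
  simp only [delG, part10_apply] at e ⊢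
  rw [e, e, e, e]
  simp only [smul_apply, sub_apply, part10_apply]
  rw [fderiv_fderiv_comm h w v, fderiv_fderiv_comm h w, fderiv_fderiv_comm h (Complex.I • w) v,
    fderiv_fderiv_comm h (Complex.I • w)]
  module

/-- `∂̄_v ∂_w q = ∂_w ∂̄_v q`. -/
lemma delbarG_delG_comm {q : Cn n → B} {z : Cn n} (h : ContDiffAt ℝ ∞ q z) (v w : Cn n) :
    delbarG (delG q) z v w = delG (delbarG q) z w v := by
  have hd := (differentiableAt_of_smooth (contDiffAt_fderiv h))
  have e (v : Cn n) : fderiv ℝ (delG q) z v = part10 (fderiv ℝ (fderiv ℝ q) z v) :=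
    fderiv_part10 hd v
  have e' (v : Cn n) : fderiv ℝ (delbarG q) z v = part01 (fderiv ℝ (fderiv ℝ q) z v) :=
    fderiv_part01 hd v
  have l : delbarG (delG q) z = part01 (fderiv ℝ (delG q) z) := rfl
  have l' : delG (delbarG q) z = part10 (fderiv ℝ (delbarG q) z) := rfl
  rw [l, l', part01_apply, part10_apply, e, e, e', e']
  simp only [smul_apply, sub_apply, part10_apply,
    add_apply, part01_apply]
  rw [fderiv_fderiv_comm h w v, fderiv_fderiv_comm h w, fderiv_fderiv_comm h (Complex.I • w) v,
    fderiv_fderiv_comm h (Complex.I • w)]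
  module

end Parts

/-! ### Conjugation -/

lemma fderiv_conj (q : Cn n → ℂ) (z v : Cn n) :
    fderiv ℝ (fun y => conj (q y)) z v = conj (fderiv ℝ q z v) := by
  have : (fun y => conj (q y)) = (Complex.conjCLE : ℂ ≃L[ℝ] ℂ) ∘ q := rfl
  rw [this, ContinuousLinearEquiv.comp_fderiv]
  rfl

lemma delG_conj (q : Cn n → ℂ) (z v : Cn n) :
    delG (fun y => conj (q y)) z v = conj (delbarG q z v) := by
  simp only [delG, delbarG, part10_apply, part01_apply, fderiv_conj]
  simp [smul_eq_mul, sub_eq_add_neg, Complex.conj_ofNat]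

lemma delbarG_conj (q : Cn n → ℂ) (z v : Cn n) :
    delbarG (fun y => conj (q y)) z v = conj (delG q z v) := by
  simp only [delG, delbarG, part10_apply, part01_apply, fderiv_conj]
  simp [smul_eq_mul, sub_eq_add_neg, Complex.conj_ofNat]

lemma delbar_toC (f : Cn n → ℝ) (z v : Cn n) :
    delbarG (toC f) z v = conj (delG (toC f) z v) := by
  rw [← delbarG_conj]; simp [toC, Complex.conj_ofReal]; rfl

/-! ### The derivatives of a real function up to third order -/

/-- The Levi form as a field of real bilinear forms. -/
def leviL (f : Cn n → ℝ) : Cn n → Cn n →L[ℝ] Cn n →L[ℝ] ℂ := delG (delbarG (toC f))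

/-- `f_{ab}`, as a field of bilinear forms. -/
def hessL (f : Cn n → ℝ) : Cn n → Cn n →L[ℝ] Cn n →L[ℝ] ℂ := delG (delG (toC f))

/-- `f_{cab̄}`, as a field of trilinear forms with arguments in this order. -/
def thirdL (f : Cn n → ℝ) : Cn n → Cn n →L[ℝ] Cn n →L[ℝ] Cn n →L[ℝ] ℂ := delG (leviL f)

section Real

variable {f : Cn n → ℝ} {z : Cn n}

lemma contDiffAt_toC (h : ContDiffAt ℝ ∞ f z) : ContDiffAt ℝ ∞ (toC f) z :=
  (Complex.ofRealCLM.contDiff.contDiffAt).comp z h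

lemma contDiffAt_leviL (h : ContDiffAt ℝ ∞ f z) : ContDiffAt ℝ ∞ (leviL f) z :=
  contDiffAt_delG (contDiffAt_delbarG (contDiffAt_toC h))

lemma contDiffAt_hessL (h : ContDiffAt ℝ ∞ f z) : ContDiffAt ℝ ∞ (hessL f) z :=
  contDiffAt_delG (contDiffAt_delG (contDiffAt_toC h))

lemma contDiffAt_thirdL (h : ContDiffAt ℝ ∞ f z) : ContDiffAt ℝ ∞ (thirdL f) z :=
  contDiffAt_delG (contDiffAt_leviL h)

lemma levi_eq (h : ContDiffAt ℝ ∞ f z) (v w : Cn n) : levi (toC f) z v w = leviL f z v w :=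
  delG_eval (differentiableAt_of_smooth (contDiffAt_delbarG (contDiffAt_toC h))) v w

lemma leviL_conj (h : ContDiffAt ℝ ∞ f z) (v w : Cn n) :
    conj (leviL f z v w) = leviL f z w v := by
  have h1 := contDiffAt_delbarG (contDiffAt_toC h)
  have h2 := contDiffAt_delG (contDiffAt_toC h)
  rw [leviL, ← delbarG_delG_comm (contDiffAt_toC h), ← delG_eval (differentiableAt_of_smooth h1),
    ← delbarG_eval (differentiableAt_of_smooth h2), ← delG_conj]
  congr 2
  simp only [delbar_toC]

lemma leviL_smul_left (c : ℂ) (v w : Cn n) : leviL f z (c • v) w = c * leviL f z v w := by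
  rw [leviL, delG_smul]; rfl

lemma leviL_smul_right (h : ContDiffAt ℝ ∞ f z) (c : ℂ) (v w : Cn n) :
    leviL f z v (c • w) = conj c * leviL f z v w := by
  rw [← leviL_conj h, leviL_smul_left, map_mul, leviL_conj h]

lemma hessL_comm (h : ContDiffAt ℝ ∞ f z) (v w : Cn n) : hessL f z v w = hessL f z w v :=
  delG_delG_comm (contDiffAt_toC h) v w

lemma hessL_smul_left (c : ℂ) (v w : Cn n) : hessL f z (c • v) w = c * hessL f z v w := by
  rw [hessL, delG_smul]; rfl

lemma hessL_smul_right (h : ContDiffAt ℝ ∞ f z) (c : ℂ) (v w : Cn n) :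
    hessL f z v (c • w) = c * hessL f z v w := by
  rw [hessL_comm h, hessL_smul_left, hessL_comm h]

lemma thirdL_comm (h : ContDiffAt ℝ ∞ f z) (v u w : Cn n) :
    thirdL f z v u w = thirdL f z u v w := by
  rw [thirdL, leviL, delG_delG_comm (contDiffAt_delbarG (contDiffAt_toC h))]

lemma thirdL_smul_left (c : ℂ) (v u w : Cn n) :
    thirdL f z (c • v) u w = c * thirdL f z v u w := by
  rw [thirdL, delG_smul]; rfl

lemma thirdL_smul_mid (h : ContDiffAt ℝ ∞ f z) (c : ℂ) (v u w : Cn n) :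
    thirdL f z v (c • u) w = c * thirdL f z v u w := by
  rw [thirdL_comm h, thirdL_smul_left, thirdL_comm h]

/-- `D_v (∂f)(w) = f_{ab} v^a w^b + f_{ab̄} w^a v^b̄`. -/
lemma fderiv_del (h : ContDiffAt ℝ ∞ f z) (v w : Cn n) :
    fderiv ℝ (delG (toC f)) z v w = hessL f z v w + leviL f z w v := by
  rw [leviL, ← delbarG_delG_comm (contDiffAt_toC h), hessL, ← add_apply,
    delG_add_delbarG]

lemma delbarG_leviL (h : ∀ᶠ y in nhds z, ContDiffAt ℝ ∞ f y) (v u w : Cn n) :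
    delbarG (leviL f) z v u w = conj (thirdL f z v w u) := by
  have h1 := (differentiableAt_of_smooth (contDiffAt_leviL h.self_of_nhds))
  have h2 (u : Cn n) : DifferentiableAt ℝ (fun y => leviL f y u) z :=
    h1.clm_apply (differentiableAt_const u)
  rw [thirdL, ← delG_eval h1, ← delbarG_eval h1, ← delG_eval (h2 w), ← delbarG_eval (h2 u),
    ← delbarG_conj]
  have : (fun y => leviL f y u w) =ᶠ[nhds z] fun y => conj (leviL f y w u) := by
    filter_upwards [h] with y hy
    rw [leviL_conj hy]
  simp only [delbarG, this.fderiv_eq]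

/-- `D_v (f_{ab̄}) u^a w^b̄ = f_{cab̄} v^c u^a w^b̄ + conj (f_{cab̄} v^c w^a u^b̄)`. -/
lemma fderiv_leviL (h : ∀ᶠ y in nhds z, ContDiffAt ℝ ∞ f y) (v u w : Cn n) :
    fderiv ℝ (leviL f) z v u w = thirdL f z v u w + conj (thirdL f z v w u) := by
  rw [← delbarG_leviL h, thirdL]
  exact (DFunLike.congr_fun (DFunLike.congr_fun (delG_add_delbarG (leviL f) z v) u) w).symm

lemma thirdL_smul_right (h : ∀ᶠ y in nhds z, ContDiffAt ℝ ∞ f y) (c : ℂ) (v u w : Cn n) :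
    thirdL f z v u (c • w) = conj c * thirdL f z v u w := by
  have h' := h.self_of_nhds
  have e : conj (thirdL f z v u (c • w)) = conj (conj c * thirdL f z v u w) := by
    rw [← delbarG_leviL h, map_mul, ← delbarG_leviL h, Complex.conj_conj]
    have h1 := (differentiableAt_of_smooth (contDiffAt_leviL h'))
    have h2 (u : Cn n) : DifferentiableAt ℝ (fun y => leviL f y u) z :=
      h1.clm_apply (differentiableAt_const u)
    rw [← delbarG_eval h1, ← delbarG_eval h1, ← delbarG_eval (h2 w), ← delbarG_eval (h2 _)]
    simp only [leviL_smul_left, delbarG, part01_apply]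
    rw [fderiv_const_mul ((h2 w).clm_apply (differentiableAt_const u))]
    simp only [smul_apply, smul_eq_mul]
    ring
  exact (starRingEnd ℂ).injective e

end Real

/-! ### Strict pseudoconvexity and the transverse field at a point -/

lemma sum_coordVec (v : Cn n) : ∑ a, v a • coordVec a = v := by
  ext b
  simp [coordVec, Finset.sum_apply, Pi.single_apply]

/-- The Levi form of `f` is positive on the nonzero vectors of the kernel of `∂f ≠ 0`. -/
def IsStrictAt (f : Cn n → ℝ) (z : Cn n) : Prop :=
  delG (toC f) z ≠ 0 ∧ ∀ V : Cn n, V ≠ 0 → delG (toC f) z V = 0 → 0 < (leviL f z V V).re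

/-- The coordinates of a covector, as a vector. -/
def coordCovector : OneCovector n →L[ℝ] Cn n :=
  ∑ a, (ContinuousLinearMap.apply ℝ ℂ (coordVec a)).smulRight (coordVec a)

lemma coordCovector_apply (η : OneCovector n) (a : Fin (n + 1)) :
    coordCovector η a = η (coordVec a) := by
  simp [coordCovector, coordVec, Finset.sum_apply, Pi.single_apply]

/-- The bordered Levi form `(x, s) ↦ (f_{ab̄} x^a - s f_b̄, f_a x^a)`. The transverse field and
curvature are the solution of the linear system with right hand side `(0, 1)`. -/
def bordered (f : Cn n → ℝ) (z : Cn n) : (Cn n × ℂ) →L[ℝ] (Cn n × ℂ) :=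
  (ContinuousLinearMap.inl ℝ (Cn n) ℂ).comp
    ((coordCovector.comp (leviL f z)).comp (ContinuousLinearMap.fst ℝ (Cn n) ℂ)
      - ((ContinuousLinearMap.lsmul ℝ ℂ : ℂ →L[ℝ] Cn n →L[ℝ] Cn n).flip
          (coordCovector (delbarG (toC f) z))).comp (ContinuousLinearMap.snd ℝ (Cn n) ℂ))
  + (ContinuousLinearMap.inr ℝ (Cn n) ℂ).comp
      ((delG (toC f) z).comp (ContinuousLinearMap.fst ℝ (Cn n) ℂ))

lemma bordered_apply (f : Cn n → ℝ) (z x : Cn n) (s : ℂ) :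
    bordered f z (x, s) =
      (coordCovector (leviL f z x) - s • coordCovector (delbarG (toC f) z),
        delG (toC f) z x) := by
  simp [bordered]

/-- The solution `(ξ, r)` of `f_{ab̄} ξ^a = r f_b̄`, `f_a ξ^a = 1`. -/
def transversePair (f : Cn n → ℝ) (z : Cn n) : Cn n × ℂ := (bordered f z).inverse (0, 1)

section

variable {f : Cn n → ℝ} {z : Cn n}

lemma bordered_eq_iff (h : ContDiffAt ℝ ∞ f z) (x : Cn n) (s t : ℂ) :
    bordered f z (x, s) = (0, t) ↔
      (∀ w, leviL f z x w = s * conj (delG (toC f) z w)) ∧ delG (toC f) z x = t := by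
  rw [bordered_apply, Prod.mk.injEq]
  refine and_congr_left fun _ => ⟨fun e w => ?_, fun e => ?_⟩
  · have ea (a) : leviL f z x (coordVec a) = s * conj (delG (toC f) z (coordVec a)) := by
      have := congrArg (fun v : Cn n => v a) e
      simp only [PiLp.sub_apply, PiLp.smul_apply, coordCovector_apply, delbar_toC, smul_eq_mul,
        PiLp.zero_apply] at this
      linear_combination this
    rw [← sum_coordVec w]
    simp only [map_sum, leviL_smul_right h, ea, delG_smul, smul_eq_mul, map_mul, Finset.mul_sum]
    exact Finset.sum_congr rfl fun a _ => by ring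
  · ext a
    simp only [PiLp.sub_apply, PiLp.smul_apply, coordCovector_apply, delbar_toC, smul_eq_mul,
        PiLp.zero_apply, e, sub_self]

lemma bordered_injective (h : ContDiffAt ℝ ∞ f z) (hs : IsStrictAt f z) :
    Function.Injective (bordered f z) := by
  rw [injective_iff_map_eq_zero]
  rintro ⟨x, s⟩ e
  obtain ⟨e1, e2⟩ := (bordered_eq_iff h x s 0).1 e
  have hx : x = 0 := by
    by_contra hx
    have := hs.2 x hx e2
    rw [e1, e2] at this
    simp at this
  have hs0 : s = 0 := by
    by_contra hs0
    refine hs.1 (ContinuousLinearMap.ext fun w => ?_)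
    have := e1 w
    rw [hx, map_zero] at this
    simpa [hs0] using this.symm
  simp [hx, hs0]

/-- The bordered Levi form is invertible at a strictly pseudoconvex point. -/
def borderedEquiv (h : ContDiffAt ℝ ∞ f z) (hs : IsStrictAt f z) :
    (Cn n × ℂ) ≃L[ℝ] (Cn n × ℂ) :=
  (LinearEquiv.ofInjectiveEndo (bordered f z).toLinearMap
    (bordered_injective h hs)).toContinuousLinearEquiv

lemma coe_borderedEquiv (h : ContDiffAt ℝ ∞ f z) (hs : IsStrictAt f z) :
    (borderedEquiv h hs : (Cn n × ℂ) →L[ℝ] (Cn n × ℂ)) = bordered f z := rfl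

lemma bordered_transversePair (h : ContDiffAt ℝ ∞ f z) (hs : IsStrictAt f z) :
    bordered f z (transversePair f z) = (0, 1) := by
  rw [transversePair, ← coe_borderedEquiv h hs, ContinuousLinearMap.inverse_equiv]
  simp

lemma contDiffAt_transversePair (h : ContDiffAt ℝ ∞ f z) (hs : IsStrictAt f z) :
    ContDiffAt ℝ ∞ (transversePair f) z := by
  have h1 : ContDiffAt ℝ ∞ (bordered f) z := by
    refine ContDiffAt.add (contDiffAt_const.clm_comp (ContDiffAt.sub
      ((contDiffAt_const.clm_comp (contDiffAt_leviL h)).clm_comp contDiffAt_const)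
      (ContDiffAt.clm_comp ?_ contDiffAt_const)))
      (contDiffAt_const.clm_comp ((contDiffAt_delG (contDiffAt_toC h)).clm_comp contDiffAt_const))
    exact contDiffAt_const.clm_apply
      (contDiffAt_const.clm_apply (contDiffAt_delbarG (contDiffAt_toC h)))
  have h2 : ContDiffAt ℝ ∞ ContinuousLinearMap.inverse (bordered f z) := by
    rw [← coe_borderedEquiv h hs]
    exact contDiffAt_map_inverse _
  exact (h2.comp z h1).clm_apply contDiffAt_const

/-- The transverse curvature. -/
def transCurv (f : Cn n → ℝ) (z : Cn n) : ℝ := (transversePair f z).2.re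

/-- The field `ξ`. -/
def transField (f : Cn n → ℝ) (z : Cn n) : Cn n := (transversePair f z).1

lemma contDiffAt_transField (h : ContDiffAt ℝ ∞ f z) (hs : IsStrictAt f z) :
    ContDiffAt ℝ ∞ (transField f) z := (contDiffAt_transversePair h hs).fst

lemma contDiffAt_transCurv (h : ContDiffAt ℝ ∞ f z) (hs : IsStrictAt f z) :
    ContDiffAt ℝ ∞ (transCurv f) z :=
  Complex.reCLM.contDiff.contDiffAt.comp z (contDiffAt_transversePair h hs).snd

lemma isTransverseAt_iff (h : ContDiffAt ℝ ∞ f z) (v : Cn n) (s : ℝ) :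
    IsTransverseAt f z v s ↔ bordered f z (v, (s : ℂ)) = (0, 1) := by
  rw [bordered_eq_iff h, IsTransverseAt, and_comm]
  refine and_congr_left fun _ => forall_congr' fun w => ?_
  rw [levi_eq h, ← leviL_conj h, del_eq_delG, ← (starRingEnd ℂ).injective.eq_iff]
  simp [Complex.conj_ofReal]

lemma isTransverseAt_transField (h : ContDiffAt ℝ ∞ f z) (hs : IsStrictAt f z) :
    IsTransverseAt f z (transField f z) (transCurv f z) := by
  have e := bordered_transversePair h hs
  have e' := (bordered_eq_iff h (transversePair f z).1 (transversePair f z).2 1).1 e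
  -- the curvature is the value of the hermitian Levi form on `ξ`, hence real
  have hr : conj (transversePair f z).2 = (transversePair f z).2 := by
    have h1 := e'.1 (transversePair f z).1
    rw [e'.2, map_one, mul_one] at h1
    rw [← h1, leviL_conj h]
  rw [isTransverseAt_iff h, transCurv, Complex.conj_eq_iff_re.1 hr]
  exact e

lemma isTransverseAt_unique (h : ContDiffAt ℝ ∞ f z) (hs : IsStrictAt f z) {v : Cn n} {s : ℝ}
    (e : IsTransverseAt f z v s) : v = transField f z ∧ s = transCurv f z := by
  have := bordered_injective h hs (((isTransverseAt_iff h v s).1 e).trans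
    ((isTransverseAt_iff h _ _).1 (isTransverseAt_transField h hs)).symm)
  simpa using this

/-- Strict pseudoconvexity is an open condition. -/
lemma eventually_isStrictAt (h : ∀ᶠ y in nhds z, ContDiffAt ℝ ∞ f y) (hs : IsStrictAt f z) :
    ∀ᶠ y in nhds z, IsStrictAt f y := by
  have hz := h.self_of_nhds
  have c1 := (contDiffAt_delG (contDiffAt_toC hz)).continuousAt
  have c2 := (contDiffAt_leviL hz).continuousAt
  have key : ∀ᶠ y in nhds z, ∀ V ∈ Metric.sphere (0 : Cn n) 1,
      delG (toC f) y V ≠ 0 ∨ 0 < (leviL f y V V).re := by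
    refine IsCompact.eventually_forall_of_forall_eventually (isCompact_sphere _ _) fun V hV => ?_
    have hV0 : V ≠ 0 := by rintro rfl; simp at hV
    have cz : ContinuousAt (fun q : Cn n × Cn n => q.1) (z, V) := continuousAt_fst
    have cV : ContinuousAt (fun q : Cn n × Cn n => q.2) (z, V) := continuousAt_snd
    by_cases hp : delG (toC f) z V = 0
    · have c : ContinuousAt (fun q : Cn n × Cn n => (leviL f q.1 q.2 q.2).re) (z, V) :=
        Complex.continuous_re.continuousAt.comp
          (((ContinuousAt.comp (f := fun q : Cn n × Cn n => q.1) c2 cz).clm_apply cV).clm_apply cV)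
      filter_upwards [c.eventually (lt_mem_nhds (hs.2 V hV0 hp))] with q hq using Or.inr hq
    · have c : ContinuousAt (fun q : Cn n × Cn n => delG (toC f) q.1 q.2) (z, V) :=
        have c' : ContinuousAt (fun q : Cn n × Cn n => delG (toC f) q.1) (z, V) :=
          ContinuousAt.comp (g := delG (toC f)) (f := fun q : Cn n × Cn n => q.1) c1 cz
        c'.clm_apply cV
      filter_upwards [c.eventually_ne hp] with q hq using Or.inl hq
  filter_upwards [key, c1.eventually_ne hs.1, h] with y hy hy' hf
  refine ⟨hy', fun V hV hp => ?_⟩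
  have hn : ‖V‖ ≠ 0 := norm_ne_zero_iff.2 hV
  set c : ℂ := ((‖V‖⁻¹ : ℝ) : ℂ) with hc
  rcases hy (c • V) (by simp [norm_smul, hc, hn]) with h1 | h1
  · rw [delG_smul, hp, smul_zero] at h1
    exact absurd rfl h1
  · rw [leviL_smul_left, leviL_smul_right hf, ← mul_assoc, hc, Complex.conj_ofReal,
      ← Complex.ofReal_mul, Complex.re_ofReal_mul] at h1
    exact pos_of_mul_pos_right h1 (by positivity)

/-- The condition that cuts out the neighbourhood of the boundary: strict pseudoconvexity together
with `1 - r f > 0`. -/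
def IsGoodAt (f : Cn n → ℝ) (z : Cn n) : Prop :=
  IsStrictAt f z ∧ ∀ (v : Cn n) (s : ℝ), IsTransverseAt f z v s → 0 < 1 - s * f z

lemma eventually_isGoodAt (h : ∀ᶠ y in nhds z, ContDiffAt ℝ ∞ f y) (hs : IsStrictAt f z)
    (h0 : f z = 0) : ∀ᶠ y in nhds z, IsGoodAt f y := by
  have hz := h.self_of_nhds
  have c : ContinuousAt (fun y => 1 - transCurv f y * f y) z :=
    continuousAt_const.sub ((contDiffAt_transCurv hz hs).continuousAt.mul hz.continuousAt)
  filter_upwards [eventually_isStrictAt h hs, h,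
    c.eventually (lt_mem_nhds (by simp [h0] : (0 : ℝ) < 1 - transCurv f z * f z))] with y h1 h2 h3
  refine ⟨h1, fun v s e => ?_⟩
  rwa [(isTransverseAt_unique h2 h1 e).2]

end

/-! ### Holomorphic changes of coordinates -/

section Transition

variable {f f' : Cn n → ℝ} {z : Cn n} {τ : Cn n → Cn n}

lemma fderiv_comp_holomorphic (hτ : DifferentiableAt ℂ τ z) (hf' : ContDiffAt ℝ ∞ f' (τ z))
    (v : Cn n) :
    fderiv ℝ (toC (f' ∘ τ)) z v = fderiv ℝ (toC f') (τ z) (fderiv ℂ τ z v) := by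
  have : toC (f' ∘ τ) = toC f' ∘ τ := rfl
  rw [this, fderiv_comp z (differentiableAt_of_smooth (contDiffAt_toC hf'))
    (hτ.restrictScalars ℝ), hτ.fderiv_restrictScalars ℝ]
  rfl

lemma delG_comp_holomorphic (hτ : DifferentiableAt ℂ τ z) (hf' : ContDiffAt ℝ ∞ f' (τ z))
    (v : Cn n) :
    delG (toC (f' ∘ τ)) z v = delG (toC f') (τ z) (fderiv ℂ τ z v) := by
  simp only [delG, part10_apply, fderiv_comp_holomorphic hτ hf', map_smul]

lemma leviL_comp_holomorphic (hτ : ContDiffAt ℂ ω τ z)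
    (hf' : ∀ᶠ y in nhds (τ z), ContDiffAt ℝ ∞ f' y) (v w : Cn n) :
    leviL (f' ∘ τ) z v w = leviL f' (τ z) (fderiv ℂ τ z v) (fderiv ℂ τ z w) := by
  have hτz : DifferentiableAt ℂ τ z := hτ.differentiableAt (by simp)
  have hz := hf'.self_of_nhds
  have hτR : ContDiffAt ℝ ∞ τ z := (hτ.restrict_scalars ℝ).of_le (by simp)
  have hfz : ContDiffAt ℝ ∞ (f' ∘ τ) z := hz.comp z hτR
  have h1 : ContDiffAt ℝ ∞ (delbarG (toC f')) (τ z) := contDiffAt_delbarG (contDiffAt_toC hz)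
  -- `∂̄(f' ∘ τ)(w) = ∂̄f'(τ' w)`; differentiating `τ' w` produces a complex linear term, on which
  -- the antilinear form `∂̄f'` has no `(1,0)`-part
  have e : (fun y => delbarG (toC (f' ∘ τ)) y w)
      =ᶠ[nhds z] fun y => delbarG (toC f') (τ y) (fderiv ℂ τ y w) := by
    filter_upwards [hτ.eventually (by simp), hτz.continuousAt.eventually hf'] with y hy hy'
    rw [delbar_toC, delbar_toC, delG_comp_holomorphic (hy.differentiableAt (by simp)) hy']
  have hw : DifferentiableAt ℂ (fun y => fderiv ℂ τ y w) z :=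
    ((hτ.fderiv_right (m := ω) (by simp)).differentiableAt (by simp)).clm_apply
      (differentiableAt_const w)
  have hwR := (hw.hasFDerivAt).restrictScalars ℝ
  have hb : HasFDerivAt (fun y => delbarG (toC f') (τ y))
      ((fderiv ℝ (delbarG (toC f')) (τ z)).comp ((fderiv ℂ τ z).restrictScalars ℝ)) z :=
    (differentiableAt_of_smooth h1).hasFDerivAt.comp z (hτz.hasFDerivAt.restrictScalars ℝ)
  have hd := hb.clm_apply hwR
  rw [← levi_eq hfz, levi, del_eq_delG, delbar_eq_delbarG, delG, e.fderiv_eq, hd.fderiv,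
    leviL, delG]
  simp only [part10_apply, add_apply, ContinuousLinearMap.coe_comp, Function.comp_apply,
    ContinuousLinearMap.flip_apply, ContinuousLinearMap.coe_restrictScalars', map_smul,
    delbarG_smul, Complex.conj_I, smul_apply, sub_apply, smul_eq_mul]
  linear_combination (exp := 1) (1 / 2 : ℂ) * (delbarG (toC f') (τ z))
    ((fderiv ℂ (fun y => (fderiv ℂ τ y) w) z) v) * Complex.I_mul_I

lemma isTransverseAt_comp_holomorphic (hτ : ContDiffAt ℂ ω τ z)
    (hf' : ∀ᶠ y in nhds (τ z), ContDiffAt ℝ ∞ f' y)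
    (hsurj : Function.Surjective (fderiv ℂ τ z)) {v : Cn n} {s : ℝ}
    (e : IsTransverseAt (f' ∘ τ) z v s) : IsTransverseAt f' (τ z) (fderiv ℂ τ z v) s := by
  have hz := hf'.self_of_nhds
  have hτz : DifferentiableAt ℂ τ z := hτ.differentiableAt (by simp)
  have hfz : ContDiffAt ℝ ∞ (f' ∘ τ) z :=
    hz.comp z ((hτ.restrict_scalars ℝ).of_le (by simp))
  obtain ⟨e1, e2⟩ := e
  rw [del_eq_delG] at e1 e2
  refine ⟨by rw [del_eq_delG, ← delG_comp_holomorphic hτz hz, e1], fun V => ?_⟩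
  obtain ⟨V, rfl⟩ := hsurj V
  rw [del_eq_delG, ← delG_comp_holomorphic hτz hz, ← e2, levi_eq hz, levi_eq hfz,
    leviL_comp_holomorphic hτ hf']

lemma isStrictAt_comp_holomorphic (hτ : ContDiffAt ℂ ω τ z)
    (hf' : ∀ᶠ y in nhds (τ z), ContDiffAt ℝ ∞ f' y)
    (hbij : Function.Bijective (fderiv ℂ τ z)) (h : IsStrictAt f' (τ z)) :
    IsStrictAt (f' ∘ τ) z := by
  have hz := hf'.self_of_nhds
  have hτz : DifferentiableAt ℂ τ z := hτ.differentiableAt (by simp)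
  refine ⟨fun h0 => h.1 (ContinuousLinearMap.ext fun V => ?_), fun V hV hp => ?_⟩
  · obtain ⟨V, rfl⟩ := hbij.2 V
    rw [← delG_comp_holomorphic hτz hz, h0]
    rfl
  · rw [leviL_comp_holomorphic hτ hf']
    refine h.2 _ (fun h0 => hV (hbij.1 (by rw [h0, map_zero]))) ?_
    rw [← delG_comp_holomorphic hτz hz, hp]

/-- The condition defining the neighbourhood of the boundary does not depend on the holomorphic
coordinates. -/
lemma isGoodAt_comp_holomorphic (hτ : ContDiffAt ℂ ω τ z)
    (hf' : ∀ᶠ y in nhds (τ z), ContDiffAt ℝ ∞ f' y)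
    (hbij : Function.Bijective (fderiv ℂ τ z)) (h : IsGoodAt f' (τ z)) :
    IsGoodAt (f' ∘ τ) z :=
  ⟨isStrictAt_comp_holomorphic hτ hf' hbij h.1, fun _ _ e =>
    h.2 _ _ (isTransverseAt_comp_holomorphic hτ hf' hbij.2 e)⟩

end Transition

/-! ### Admissible frames -/

/-- The local situation: on the open set `U` the function `f` is smooth and strictly pseudoconvex,
`ξ` and `r` are its transverse field and curvature, `1 - r f > 0`, and `W`, `θ` are an admissible
frame and its coframe. -/
structure IsLocalFrame (f : Cn n → ℝ) (U : Set (Cn n)) (ξ : Cn n → Cn n) (r : Cn n → ℝ)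
    (W : Fin n → Cn n → Cn n) (θ : Fin (n + 1) → Cn n → OneCovector n) : Prop where
  isOpen : IsOpen U
  smooth : ∀ z ∈ U, ContDiffAt ℝ ∞ f z
  strict : ∀ z ∈ U, IsStrictAt f z
  smooth_field : ∀ z ∈ U, ContDiffAt ℝ ∞ ξ z
  smooth_curv : ∀ z ∈ U, ContDiffAt ℝ ∞ r z
  eqns : ∀ z ∈ U, IsTransverseAt f z (ξ z) (r z)
  pos : ∀ z ∈ U, 0 < 1 - r z * f z
  admissible : IsAdmissible f U ξ W θ

@[simp] lemma fullFrame_zero (ξ : Cn n → Cn n) (W : Fin n → Cn n → Cn n) :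
    fullFrame ξ W 0 = ξ := rfl

@[simp] lemma fullFrame_succ (ξ : Cn n → Cn n) (W : Fin n → Cn n → Cn n) (α : Fin n) :
    fullFrame ξ W α.succ = W α := rfl

namespace IsLocalFrame

variable {f : Cn n → ℝ} {U : Set (Cn n)} {ξ : Cn n → Cn n} {r : Cn n → ℝ}
  {W : Fin n → Cn n → Cn n} {θ : Fin (n + 1) → Cn n → OneCovector n} {z : Cn n}

section Pointwise

variable (D : IsLocalFrame f U ξ r W θ) (hz : z ∈ U)
include D hz

lemma mem_nhds : U ∈ nhds z := D.isOpen.mem_nhds hz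

lemma eventually_mem : ∀ᶠ y in nhds z, y ∈ U := D.mem_nhds hz

lemma eventually_smooth : ∀ᶠ y in nhds z, ContDiffAt ℝ ∞ f y :=
  (D.eventually_mem hz).mono fun y hy => D.smooth y hy

lemma smooth_frame (i : Fin (n + 1)) : ContDiffAt ℝ ∞ (fullFrame ξ W i) z := by
  refine Fin.cases ?_ (fun α => ?_) i
  · exact D.smooth_field z hz
  · exact (D.admissible.smooth_frame α).contDiffAt (D.mem_nhds hz)

lemma smooth_coframe (i : Fin (n + 1)) : ContDiffAt ℝ ∞ (θ i) z :=
  (D.admissible.smooth_coframe i).contDiffAt (D.mem_nhds hz)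

lemma coframe_smul (i : Fin (n + 1)) (c : ℂ) (v : Cn n) : θ i z (c • v) = c * θ i z v :=
  map_smul_of_I (M := θ i z) (D.admissible.complex_linear i z hz) c v

lemma coframe_frame (i j : Fin (n + 1)) : θ i z (fullFrame ξ W j z) = kron i j :=
  D.admissible.dual i j z hz

lemma coframe_ext {v w : Cn n} (h : ∀ i, θ i z v = θ i z w) : v = w := by
  let Θ : Cn n →ₗ[ℂ] (Fin (n + 1) → ℂ) :=
    { toFun := fun v i => θ i z v
      map_add' := fun v w => by ext i; simp
      map_smul' := fun c v => by ext i; simp [D.coframe_smul hz] }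
  have hs : Function.Surjective Θ := fun c => by
    refine ⟨∑ j, c j • fullFrame ξ W j z, ?_⟩
    ext i
    simp [Θ, D.coframe_frame hz, kron]
  have hi : Function.Injective Θ :=
    (LinearMap.injective_iff_surjective_of_finrank_eq_finrank (by simp)).2 hs
  exact hi (funext h)

/-- A `(1,0)`-vector is the combination of the frame with its coordinates in the coframe. -/
lemma sum_frame (v : Cn n) : ∑ i, θ i z v • fullFrame ξ W i z = v :=
  D.coframe_ext hz fun i => by simp [D.coframe_smul hz, D.coframe_frame hz, kron]

lemma del_field : delG (toC f) z (ξ z) = 1 := (D.eqns z hz).1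

lemma del_frame (i : Fin (n + 1)) : delG (toC f) z (fullFrame ξ W i z) = kron i 0 := by
  refine Fin.cases ?_ (fun α => ?_) i
  · exact (D.eqns z hz).1
  · exact (D.admissible.ker α z hz).trans (by simp [kron])

lemma coframe_zero : θ 0 z = delG (toC f) z := by
  ext v
  conv_rhs => rw [← D.sum_frame hz v]
  simp [delG_smul, D.del_frame hz, kron]

/-- Decomposition of a vector along `ξ` and the kernel of `∂f`. -/
lemma eq_field_add_sum (v : Cn n) :
    v = delG (toC f) z v • ξ z + ∑ α : Fin n, θ α.succ z v • W α z := by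
  conv_lhs => rw [← D.sum_frame hz v]
  rw [Fin.sum_univ_succ, D.coframe_zero hz]
  rfl

lemma leviL_field_right (v : Cn n) : leviL f z v (ξ z) = r z * delG (toC f) z v := by
  rw [← levi_eq (D.smooth z hz)]
  exact (D.eqns z hz).2 v

lemma leviL_field_left (v : Cn n) : leviL f z (ξ z) v = r z * conj (delG (toC f) z v) := by
  rw [← leviL_conj (D.smooth z hz), D.leviL_field_right hz, map_mul, Complex.conj_ofReal]

lemma leviMatrix_apply (α β : Fin n) :
    leviMatrix f W z α β = leviL f z (W α z) (W β z) :=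
  levi_eq (D.smooth z hz) _ _

lemma del_W (α : Fin n) : delG (toC f) z (W α z) = 0 := D.admissible.ker α z hz

lemma leviL_W_right (v : Cn n) (β : Fin n) :
    leviL f z v (W β z) = ∑ α : Fin n, θ α.succ z v * leviMatrix f W z α β := by
  conv_lhs => rw [D.eq_field_add_sum hz v]
  simp [leviL_smul_left, D.leviL_field_left hz, D.del_W hz, D.leviMatrix_apply hz]

lemma leviL_W_left (v : Cn n) (β : Fin n) :
    leviL f z (W β z) v = ∑ γ : Fin n, leviMatrix f W z β γ * conj (θ γ.succ z v) := by
  rw [← leviL_conj (D.smooth z hz), D.leviL_W_right hz, map_sum]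
  refine Finset.sum_congr rfl fun γ _ => ?_
  rw [map_mul, D.leviMatrix_apply hz, D.leviMatrix_apply hz, leviL_conj (D.smooth z hz), mul_comm]

lemma posDef : (leviMatrix f W z).PosDef := by
  have hf := D.smooth z hz
  have herm : (leviMatrix f W z).IsHermitian := by
    ext α β
    rw [Matrix.conjTranspose_apply, D.leviMatrix_apply hz, D.leviMatrix_apply hz]
    exact leviL_conj hf _ _
  refine Matrix.PosDef.of_dotProduct_mulVec_pos herm fun x hx => ?_
  set v : Cn n := ∑ α, conj (x α) • W α z with hv
  have hθ (α : Fin n) : θ α.succ z v = conj (x α) := by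
    have := fun β : Fin n => D.coframe_frame hz α.succ β.succ
    simp only [fullFrame_succ] at this
    simp [hv, D.coframe_smul hz, this, kron]
  have hp : delG (toC f) z v = 0 := by simp [hv, delG_smul, D.del_W hz]
  have hv0 : v ≠ 0 := by
    intro h0
    refine hx (funext fun α => ?_)
    have := hθ α
    rw [h0, map_zero] at this
    simpa using this.symm
  have e : star x ⬝ᵥ (leviMatrix f W z).mulVec x = leviL f z v v := by
    have : leviL f z v v = ∑ α, conj (x α) * leviL f z (W α z) v := by
      have hl : leviL f z v = ∑ α, leviL f z (conj (x α) • W α z) := by rw [hv, map_sum]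
      rw [hl]
      simp only [sum_apply, leviL_smul_left]
    rw [this]
    simp only [dotProduct, Matrix.mulVec, D.leviL_W_left hz, hθ, Complex.conj_conj]
    rfl
  rw [e, Complex.lt_def]
  refine ⟨(D.strict z hz).2 v hv0 hp, ?_⟩
  exact (Complex.conj_eq_iff_im.1 (leviL_conj hf v v)).symm

lemma isUnit_det : IsUnit (leviMatrix f W z).det := by
  rw [← Matrix.isUnit_iff_isUnit_det]
  exact (D.posDef hz).isUnit

/-- The tangential components of a vector, from its products with the frame. -/
lemma coframe_succ (v : Cn n) (α : Fin n) :
    θ α.succ z v = ∑ β, (leviMatrix f W z)⁻¹ β α * leviL f z v (W β z) := by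
  have h := Matrix.mul_nonsing_inv _ (D.isUnit_det hz)
  have : ∀ γ : Fin n, ∑ β, leviMatrix f W z γ β * (leviMatrix f W z)⁻¹ β α =
      if γ = α then 1 else 0 := fun γ => by
    rw [← Matrix.mul_apply, h, Matrix.one_apply]
  calc θ α.succ z v = ∑ γ : Fin n, θ γ.succ z v * (if γ = α then 1 else 0) := by simp
    _ = _ := by
      simp_rw [← this, D.leviL_W_right hz, Finset.mul_sum]
      rw [Finset.sum_comm]
      exact Finset.sum_congr rfl fun _ _ => Finset.sum_congr rfl fun _ _ => by ring

lemma sum_mul_leviMatrix (x : Fin n → ℂ) (γ : Fin n) :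
    ∑ α, (∑ β, (leviMatrix f W z)⁻¹ β α * x β) * leviMatrix f W z α γ = x γ := by
  have h := Matrix.nonsing_inv_mul _ (D.isUnit_det hz)
  have : ∀ β : Fin n, ∑ α, (leviMatrix f W z)⁻¹ β α * leviMatrix f W z α γ =
      if β = γ then 1 else 0 := fun β => by
    rw [← Matrix.mul_apply, h, Matrix.one_apply]
  calc _ = ∑ β, x β * (if β = γ then 1 else 0) := by
        simp_rw [← this, Finset.mul_sum, Finset.sum_mul]
        rw [Finset.sum_comm]
        exact Finset.sum_congr rfl fun _ _ => Finset.sum_congr rfl fun _ _ => by ring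
    _ = x γ := by simp

/-! ### Derivatives of the frame -/

lemma fderiv_frame_zero (i : Fin (n + 1)) (v : Cn n) :
    delG (toC f) z (fderiv ℝ (fullFrame ξ W i) z v) =
      -hessL f z v (fullFrame ξ W i z) - leviL f z (fullFrame ξ W i z) v := by
  have hp := (differentiableAt_of_smooth
    (contDiffAt_delG (contDiffAt_toC (D.smooth z hz)))).hasFDerivAt
  have hF := (differentiableAt_of_smooth (D.smooth_frame hz i)).hasFDerivAt
  have hc : (fun y => delG (toC f) y (fullFrame ξ W i y)) =ᶠ[nhds z] fun _ => kron i 0 :=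
    (D.eventually_mem hz).mono fun y hy => D.del_frame hy i
  have h1 := (hp.clm_apply hF).fderiv.symm.trans hc.fderiv_eq
  have h2 := DFunLike.congr_fun h1 v
  simp only [add_apply, ContinuousLinearMap.coe_comp, Function.comp_apply,
    ContinuousLinearMap.flip_apply, fderiv_del (D.smooth z hz), fderiv_fun_const, Pi.zero_apply,
    zero_apply] at h2
  linear_combination h2

/-- The derivative of the equation `f_{ab̄} ξ^a = r f_b̄`. -/
lemma fderiv_transverse (v w : Cn n) :
    thirdL f z v (ξ z) w + conj (thirdL f z v w (ξ z)) + leviL f z (fderiv ℝ ξ z v) w =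
      fderiv ℝ (toC r) z v * conj (delG (toC f) z w)
        + r z * conj (hessL f z v w + leviL f z w v) := by
  have hf := D.smooth z hz
  have hL := (differentiableAt_of_smooth (contDiffAt_leviL hf)).hasFDerivAt
  have hξ := (differentiableAt_of_smooth (D.smooth_field z hz)).hasFDerivAt
  have hr := (differentiableAt_of_smooth (contDiffAt_toC (D.smooth_curv z hz))).hasFDerivAt
  have hp := (differentiableAt_of_smooth (contDiffAt_delG (contDiffAt_toC hf)))
  have hpw : DifferentiableAt ℝ (fun y => delG (toC f) y w) z :=
    hp.clm_apply (differentiableAt_const w)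
  have hpc : HasFDerivAt (fun y => conj (delG (toC f) y w))
      ((Complex.conjCLE : ℂ →L[ℝ] ℂ).comp (fderiv ℝ (fun y => delG (toC f) y w) z)) z :=
    (Complex.conjCLE : ℂ →L[ℝ] ℂ).hasFDerivAt.comp z hpw.hasFDerivAt
  have hc : (fun y => leviL f y (ξ y) w) =ᶠ[nhds z]
      fun y => toC r y * conj (delG (toC f) y w) :=
    (D.eventually_mem hz).mono fun y hy => D.leviL_field_left hy w
  have h1 := ((hL.clm_apply hξ).clm_apply (hasFDerivAt_const w z)).fderiv.symm.trans
    (hc.fderiv_eq.trans (hr.mul hpc).fderiv)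
  have h2 := DFunLike.congr_fun h1 v
  simp only [add_apply, ContinuousLinearMap.coe_comp, Function.comp_apply,
    ContinuousLinearMap.flip_apply, zero_apply, map_zero, zero_add, smul_apply, smul_eq_mul,
    fderiv_leviL (D.eventually_smooth hz), ContinuousLinearEquiv.coe_coe,
    fderiv_clm_eval hp, fderiv_del hf, Complex.conjCLE_apply] at h2
  rw [show toC r z = (r z : ℂ) from rfl] at h2
  linear_combination h2

lemma transverse_types (v w : Cn n) :
    (thirdL f z v (ξ z) w + leviL f z (delG ξ z v) w =
      delG (toC r) z v * conj (delG (toC f) z w) + r z * leviL f z v w) ∧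
    (conj (thirdL f z v w (ξ z)) + leviL f z (delbarG ξ z v) w =
      conj (delG (toC r) z v) * conj (delG (toC f) z w) + r z * conj (hessL f z v w)) := by
  have hf := D.smooth z hz
  have h1 := D.fderiv_transverse hz v w
  have h2 := D.fderiv_transverse hz (Complex.I • v) w
  simp only [thirdL_smul_left, hessL_smul_left, leviL_smul_right hf,
    map_mul, map_add, map_neg, neg_neg, Complex.conj_I, leviL_conj hf] at h1 h2
  rw [← delbar_toC r]
  generalize delG (toC f) z w = p at h1 h2 ⊢
  set E := (1 / 2 : ℂ) * (thirdL f z v (ξ z) w - conj (thirdL f z v w (ξ z))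
    + r z * conj (hessL f z v w) - r z * leviL f z v w) with hE
  simp only [delG, delbarG, part10_apply, part01_apply, leviL_smul_left, map_sub, map_add,
    sub_apply, add_apply, smul_eq_mul]
  constructor
  · linear_combination (1 / 2 : ℂ) * h1 - (1 / 2 : ℂ) * Complex.I * h2 + E * Complex.I_mul_I
  · linear_combination (1 / 2 : ℂ) * h1 + (1 / 2 : ℂ) * Complex.I * h2 - E * Complex.I_mul_I

end Pointwise
end IsLocalFrame

/-! ### The smooth form of the renormalized connection -/

/-- The components `C^j(u, ·)` in an admissible frame of the symmetric bilinear map `C` on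
`(1,0)`-vectors with `∂f(C(u,v)) = (f_{ab} u^a v^b - f f_{abc̄} u^a v^b ξ^c̄) / (1 - r f)` and
`f_{ab̄} C(u,v)^a W_β^b̄ = f_{abc̄} u^a v^b W_β^c̄`. -/
def cForm (f : Cn n → ℝ) (ξ : Cn n → Cn n) (r : Cn n → ℝ) (W : Fin n → Cn n → Cn n)
    (j : Fin (n + 1)) (z u : Cn n) : OneCovector n :=
  Fin.cases
    ((1 / (1 - r z * f z : ℂ)) • (hessL f z u
      - (f z : ℂ) • (ContinuousLinearMap.apply ℝ ℂ (ξ z)).comp (thirdL f z u)))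
    (fun α : Fin n => ∑ β, (leviMatrix f W z)⁻¹ β α •
      (ContinuousLinearMap.apply ℝ ℂ (W β z)).comp (thirdL f z u)) j

lemma cForm_zero_apply (f : Cn n → ℝ) (ξ : Cn n → Cn n) (r : Cn n → ℝ) (W : Fin n → Cn n → Cn n)
    (z u v : Cn n) : cForm f ξ r W 0 z u v =
      1 / (1 - r z * f z : ℂ) * (hessL f z u v - f z * thirdL f z u v (ξ z)) := rfl

lemma cForm_succ_apply (f : Cn n → ℝ) (ξ : Cn n → Cn n) (r : Cn n → ℝ) (W : Fin n → Cn n → Cn n)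
    (α : Fin n) (z u v : Cn n) : cForm f ξ r W α.succ z u v =
      ∑ β, (leviMatrix f W z)⁻¹ β α * thirdL f z u v (W β z) := by
  simp [cForm]

/-- The connection forms of the renormalized connection, in a form that makes sense on both sides of
the boundary: the flat connection of the chart plus the tensor `C`. -/
def smoothConn (f : Cn n → ℝ) (ξ : Cn n → Cn n) (r : Cn n → ℝ) (W : Fin n → Cn n → Cn n)
    (θ : Fin (n + 1) → Cn n → OneCovector n) (i j : Fin (n + 1)) (z : Cn n) : OneCovector n :=
  (θ j z).comp (fderiv ℝ (fullFrame ξ W i) z) + cForm f ξ r W j z (fullFrame ξ W i z)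

/-- The torsion `A^α_γ̄ = i θ^α(∂̄_{W_γ} ξ)` of the Graham–Lee connection. -/
def torsion (ξ : Cn n → Cn n) (W : Fin n → Cn n → Cn n)
    (θ : Fin (n + 1) → Cn n → OneCovector n) (α γ : Fin n) (z : Cn n) : ℂ :=
  Complex.I * θ α.succ z (delbarG ξ z (W γ z))

/-- The connection forms of the Graham–Lee connection, from the renormalized connection. -/
def grahamLee (f : Cn n → ℝ) (ξ : Cn n → Cn n) (r : Cn n → ℝ) (W : Fin n → Cn n → Cn n)
    (θ : Fin (n + 1) → Cn n → OneCovector n) (β α : Fin n) (z : Cn n) : OneCovector n :=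
  smoothConn f ξ r W θ β.succ α.succ z - (Complex.I * r z * kron β α) • contactForm f z

lemma smoothConn_succ_succ (f : Cn n → ℝ) (ξ : Cn n → Cn n) (r : Cn n → ℝ)
    (W : Fin n → Cn n → Cn n) (θ : Fin (n + 1) → Cn n → OneCovector n) (β α : Fin n) (z : Cn n) :
    smoothConn f ξ r W θ β.succ α.succ z =
      grahamLee f ξ r W θ β α z + (Complex.I * r z * kron β α) • contactForm f z := by
  rw [grahamLee, sub_add_cancel]

lemma contDiffAt_matrix_inv {M : Cn n → Matrix (Fin n) (Fin n) ℂ} {z : Cn n}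
    (h : ∀ α β, ContDiffAt ℝ ∞ (fun y => M y α β) z) (hu : IsUnit (M z).det) (α β : Fin n) :
    ContDiffAt ℝ ∞ (fun y => (M y)⁻¹ α β) z := by
  have hdet {N : Cn n → Matrix (Fin n) (Fin n) ℂ}
      (h : ∀ α β, ContDiffAt ℝ ∞ (fun y => N y α β) z) : ContDiffAt ℝ ∞ (fun y => (N y).det) z := by
    simp only [Matrix.det_apply, Units.smul_def]
    exact ContDiffAt.sum fun σ _ => (contDiffAt_prod fun i _ => h _ _).const_smul _
  have hadj : ContDiffAt ℝ ∞ (fun y => (M y).adjugate α β) z := by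
    simp only [Matrix.adjugate_apply]
    refine hdet fun i j => ?_
    by_cases hi : i = β
    · subst hi; simpa using contDiffAt_const
    · simpa [Matrix.updateRow_ne hi] using h i j
  simp only [Matrix.inv_def, Matrix.smul_apply, Ring.inverse_eq_inv', smul_eq_mul]
  exact ((hdet h).inv hu.ne_zero).mul hadj

namespace IsLocalFrame

variable {f : Cn n → ℝ} {U : Set (Cn n)} {ξ : Cn n → Cn n} {r : Cn n → ℝ}
  {W : Fin n → Cn n → Cn n} {θ : Fin (n + 1) → Cn n → OneCovector n} {z : Cn n}

variable (D : IsLocalFrame f U ξ r W θ) (hz : z ∈ U)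
include D hz

lemma smooth_W (α : Fin n) : ContDiffAt ℝ ∞ (W α) z := D.smooth_frame hz α.succ

lemma one_sub_ne_zero : (1 - r z * f z : ℂ) ≠ 0 := by
  have := (D.pos z hz).ne'
  exact_mod_cast this

lemma smooth_leviMatrix (α β : Fin n) : ContDiffAt ℝ ∞ (fun y => leviMatrix f W y α β) z := by
  refine (((contDiffAt_leviL (D.smooth z hz)).clm_apply (D.smooth_W hz α)).clm_apply
    (D.smooth_W hz β)).congr_of_eventuallyEq ?_
  filter_upwards [D.eventually_mem hz] with y hy using D.leviMatrix_apply hy α β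

lemma smooth_leviMatrix_inv (α β : Fin n) :
    ContDiffAt ℝ ∞ (fun y => (leviMatrix f W y)⁻¹ α β) z :=
  contDiffAt_matrix_inv (D.smooth_leviMatrix hz) (D.isUnit_det hz) α β

lemma smooth_ofReal_curv : ContDiffAt ℝ ∞ (fun y => (r y : ℂ)) z :=
  contDiffAt_toC (D.smooth_curv z hz)

lemma smooth_ofReal : ContDiffAt ℝ ∞ (fun y => (f y : ℂ)) z :=
  contDiffAt_toC (D.smooth z hz)

lemma smooth_one_div : ContDiffAt ℝ ∞ (fun y => 1 / (1 - r y * f y : ℂ)) z := by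
  simp only [one_div]
  exact (contDiffAt_const.sub ((D.smooth_ofReal_curv hz).mul (D.smooth_ofReal hz))).inv
    (D.one_sub_ne_zero hz)

lemma smooth_smoothConn (i j : Fin (n + 1)) : ContDiffAt ℝ ∞ (smoothConn f ξ r W θ i j) z := by
  have hF := D.smooth_frame hz i
  have hT := (contDiffAt_thirdL (D.smooth z hz)).clm_apply hF
  have happ {X : Cn n → Cn n} (hX : ContDiffAt ℝ ∞ X z) :
      ContDiffAt ℝ ∞ (fun y => (ContinuousLinearMap.apply ℝ ℂ (X y)).comp
        (thirdL f y (fullFrame ξ W i y))) z :=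
    (contDiffAt_const.clm_apply hX).clm_comp hT
  refine ((D.smooth_coframe hz j).clm_comp (contDiffAt_fderiv hF)).add ?_
  refine Fin.cases ?_ (fun α => ?_) j
  · exact (D.smooth_one_div hz).smul (((contDiffAt_hessL (D.smooth z hz)).clm_apply hF).sub
      ((D.smooth_ofReal hz).smul (happ (D.smooth_field z hz))))
  · have h : ContDiffAt ℝ ∞ (fun y => ∑ β, (leviMatrix f W y)⁻¹ β α •
        (ContinuousLinearMap.apply ℝ ℂ (W β y)).comp (thirdL f y (fullFrame ξ W i y))) z :=
      ContDiffAt.sum fun β _ => (D.smooth_leviMatrix_inv hz β α).smul (happ (D.smooth_W hz β))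
    exact h

lemma smooth_contactForm : ContDiffAt ℝ ∞ (contactForm f) z :=
  ((contDiffAt_delbarG (contDiffAt_toC (D.smooth z hz))).sub
    (contDiffAt_delG (contDiffAt_toC (D.smooth z hz)))).const_smul (Complex.I / 2)

lemma smooth_grahamLee (β α : Fin n) : ContDiffAt ℝ ∞ (grahamLee f ξ r W θ β α) z :=
  (D.smooth_smoothConn hz _ _).sub
    (((contDiffAt_const.mul (D.smooth_ofReal_curv hz)).mul contDiffAt_const).smul
      (D.smooth_contactForm hz))

lemma smooth_torsion (α γ : Fin n) : ContDiffAt ℝ ∞ (torsion ξ W θ α γ) z :=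
  contDiffAt_const.mul ((D.smooth_coframe hz _).clm_apply
    ((contDiffAt_delbarG (D.smooth_field z hz)).clm_apply (D.smooth_W hz γ)))

lemma cForm_comm (j : Fin (n + 1)) (u v : Cn n) :
    cForm f ξ r W j z u v = cForm f ξ r W j z v u := by
  have hf := D.smooth z hz
  refine Fin.cases ?_ (fun α => ?_) j
  · simp only [cForm_zero_apply, hessL_comm hf u v, thirdL_comm hf u v]
  · simp only [cForm_succ_apply, thirdL_comm hf u v]

lemma cForm_sum (j : Fin (n + 1)) (u v : Cn n) :
    ∑ i, θ i z u * cForm f ξ r W j z (fullFrame ξ W i z) v = cForm f ξ r W j z u v := by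
  have hs (c : ℂ) (x : Cn n) : cForm f ξ r W j z v (c • x) = c * cForm f ξ r W j z v x := by
    refine Fin.cases ?_ (fun α => ?_) j
    · simp only [cForm_zero_apply, hessL_smul_right (D.smooth z hz),
        thirdL_smul_mid (D.smooth z hz)]
      ring
    · simp only [cForm_succ_apply, thirdL_smul_mid (D.smooth z hz), Finset.mul_sum]
      exact Finset.sum_congr rfl fun _ _ => by ring
  conv_rhs => rw [← D.sum_frame hz u, D.cForm_comm hz, map_sum]
  simp only [hs, D.cForm_comm hz j v]

/-- The derivative of the coframe, in terms of the forms `θ^j(D F_i)` of the flat connection. -/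
lemma fderiv_coframe (j : Fin (n + 1)) (u v : Cn n) :
    fderiv ℝ (θ j) z u v =
      -∑ i, θ i z v * θ j z (fderiv ℝ (fullFrame ξ W i) z u) := by
  have hθ := differentiableAt_of_smooth (D.smooth_coframe hz j)
  have hlin (c : ℂ) (x : Cn n) :
      fderiv ℝ (θ j) z u (c • x) = c * fderiv ℝ (θ j) z u x := by
    rw [← fderiv_clm_eval hθ, ← fderiv_clm_eval hθ]
    have : (fun y => θ j y (c • x)) =ᶠ[nhds z] fun y => c * θ j y x :=
      (D.eventually_mem hz).mono fun y hy => D.coframe_smul hy j c x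
    rw [this.fderiv_eq, fderiv_const_mul (hθ.clm_apply (differentiableAt_const x))]
    rfl
  have hdual (i : Fin (n + 1)) : fderiv ℝ (θ j) z u (fullFrame ξ W i z) =
      -θ j z (fderiv ℝ (fullFrame ξ W i) z u) := by
    have hF := (differentiableAt_of_smooth (D.smooth_frame hz i)).hasFDerivAt
    have : (fun y => θ j y (fullFrame ξ W i y)) =ᶠ[nhds z] fun _ => kron j i :=
      (D.eventually_mem hz).mono fun y hy => D.coframe_frame hy j i
    have h1 := DFunLike.congr_fun
      ((hθ.hasFDerivAt.clm_apply hF).fderiv.symm.trans this.fderiv_eq) u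
    simp only [add_apply, ContinuousLinearMap.coe_comp, Function.comp_apply,
      ContinuousLinearMap.flip_apply, fderiv_fun_const, Pi.zero_apply, zero_apply] at h1
    linear_combination h1
  conv_lhs => rw [← D.sum_frame hz v]
  simp only [map_sum, hlin, hdual, mul_neg, Finset.sum_neg_distrib]

/-- The renormalized connection is torsion free. -/
lemma extd_coframe (j : Fin (n + 1)) :
    extd (θ j) z = ∑ i, wedge (θ i z) (smoothConn f ξ r W θ i j z) := by
  ext u v
  have hs : ∑ i, θ i z u * cForm f ξ r W j z (fullFrame ξ W i z) v =
      ∑ i, θ i z v * cForm f ξ r W j z (fullFrame ξ W i z) u := by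
    rw [D.cForm_sum hz, D.cForm_sum hz, D.cForm_comm hz]
  simp only [extd, sub_apply, ContinuousLinearMap.flip_apply, D.fderiv_coframe hz, sum_apply,
    wedge, ContinuousLinearMap.smulRight_apply, smul_apply, smul_eq_mul, smoothConn, add_apply,
    ContinuousLinearMap.coe_comp, Function.comp_apply, mul_add, add_mul, Finset.sum_sub_distrib,
    Finset.sum_add_distrib, hs]
  simp only [mul_comm]
  ring

/-- The consequence `r f_{ab} - f_{abc̄} ξ^c̄ = conj (f_{cb̄} ∂_ā ξ^c) - r_a f_b` of the equation of
the transverse curvature. -/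
lemma hess_sub_third (v w : Cn n) :
    r z * hessL f z v w - thirdL f z v w (ξ z) =
      conj (leviL f z (delbarG ξ z v) w) - delG (toC r) z v * delG (toC f) z w := by
  have := congrArg conj (D.transverse_types hz v w).2
  simp only [map_add, map_mul, Complex.conj_conj, Complex.conj_ofReal] at this
  linear_combination -this

lemma del_delbar_field (v : Cn n) :
    delG (toC f) z (delbarG ξ z v) = -(r z * conj (delG (toC f) z v)) := by
  have hf := D.smooth z hz
  have h1 := D.fderiv_frame_zero hz 0 v
  have h2 := D.fderiv_frame_zero hz 0 (Complex.I • v)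
  simp only [fullFrame_zero, hessL_smul_left, leviL_smul_right hf, Complex.conj_I,
    D.leviL_field_left hz] at h1 h2
  rw [delbarG, part01_apply, delG_smul, map_add, delG_smul, h1, h2]
  simp only [smul_eq_mul]
  linear_combination (1 / 2 : ℂ) * (r z * conj (delG (toC f) z v) - hessL f z v (ξ z))
    * Complex.I_mul_I

/-- `f_{ab̄} (∂̄_{W_γ} ξ)^a W_β^b̄ = -i A_{..}`, with the index of the torsion lowered. -/
lemma leviL_delbar_field_W (β γ : Fin n) :
    leviL f z (delbarG ξ z (W γ z)) (W β z) =
      -Complex.I * ∑ α, torsion ξ W θ α γ z * leviMatrix f W z α β := by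
  rw [D.leviL_W_right hz, Finset.mul_sum]
  refine Finset.sum_congr rfl fun α _ => ?_
  rw [torsion]
  linear_combination (θ α.succ z (delbarG ξ z (W γ z)) * leviMatrix f W z α β) * Complex.I_mul_I

lemma leviL_delbar_field_field (β : Fin n) :
    leviL f z (delbarG ξ z (ξ z)) (W β z) = -conj (lowerGrad r W β z) := by
  have hf := D.smooth z hz
  have h1 := D.hess_sub_third hz (ξ z) (W β z)
  have h2 := D.hess_sub_third hz (W β z) (ξ z)
  rw [hessL_comm hf, thirdL_comm hf, h2, D.leviL_field_right hz, D.del_delbar_field hz,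
    D.del_W hz, D.del_field hz] at h1
  have := congrArg conj h1
  simp only [map_neg, Complex.conj_conj, map_zero,
    mul_zero, neg_zero, sub_zero, mul_one, zero_sub] at this
  rw [← this, lowerGrad, del_eq_delG]

lemma coframe_delbar_field_field (α : Fin n) :
    θ α.succ z (delbarG ξ z (ξ z)) = -upperGrad f r W α z := by
  rw [D.coframe_succ hz, upperGrad, ← Finset.sum_neg_distrib]
  simp only [D.leviL_delbar_field_field hz, mul_neg]

lemma lowerTorsion_eq (β γ : Fin n) :
    conj (leviL f z (delbarG ξ z (W γ z)) (W β z)) =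
      Complex.I * lowerTorsion f W (torsion ξ W θ) β γ z := by
  rw [D.leviL_delbar_field_W hz, map_mul, map_neg, Complex.conj_I, neg_neg, lowerTorsion, map_sum]
  congr 1
  refine Finset.sum_congr rfl fun α _ => ?_
  rw [map_mul, D.leviMatrix_apply hz, D.leviMatrix_apply hz, leviL_conj (D.smooth z hz), mul_comm]

/-! ### The renormalized connection in terms of the Graham–Lee connection -/

lemma smoothConn_zero_succ (α : Fin n) :
    smoothConn f ξ r W θ 0 α.succ z =
      (r z : ℂ) • θ α.succ z
        - ∑ γ : Fin n, (Complex.I * torsion ξ W θ α γ z) • conjForm (θ γ.succ z)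
        - upperGrad f r W α z • delbarG (toC f) z := by
  ext v
  have hf := D.smooth z hz
  -- the `(1,0)`-part
  have h1 : θ α.succ z (delG ξ z v) + cForm f ξ r W α.succ z (ξ z) v = r z * θ α.succ z v := by
    rw [D.coframe_succ hz, D.coframe_succ hz, cForm_succ_apply, ← Finset.sum_add_distrib,
      Finset.mul_sum]
    refine Finset.sum_congr rfl fun β _ => ?_
    have := (D.transverse_types hz v (W β z)).1
    rw [D.del_W hz, map_zero, mul_zero, zero_add, thirdL_comm hf] at this
    linear_combination (leviMatrix f W z)⁻¹ β α * this
  -- the `(0,1)`-part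
  have h2 : θ α.succ z (delbarG ξ z v) =
      -(∑ γ : Fin n, Complex.I * torsion ξ W θ α γ z * conj (θ γ.succ z v))
        - upperGrad f r W α z * conj (delG (toC f) z v) := by
    conv_lhs => rw [D.eq_field_add_sum hz v]
    simp only [map_add, map_sum, delbarG_smul, D.coframe_smul hz,
      D.coframe_delbar_field_field hz, torsion]
    have e : ∀ γ : Fin n, conj (θ γ.succ z v) * θ α.succ z (delbarG ξ z (W γ z)) =
        -(Complex.I * (Complex.I * θ α.succ z (delbarG ξ z (W γ z))) * conj (θ γ.succ z v)) :=
      fun γ => by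
        linear_combination conj (θ γ.succ z v) * θ α.succ z (delbarG ξ z (W γ z))
          * Complex.I_mul_I
    simp only [e, Finset.sum_neg_distrib]
    ring
  have h3 : θ α.succ z (fderiv ℝ ξ z v) =
      θ α.succ z (delG ξ z v) + θ α.succ z (delbarG ξ z v) := by
    rw [← delG_add_delbarG, map_add]
  simp only [smoothConn, fullFrame_zero, add_apply, ContinuousLinearMap.coe_comp,
    Function.comp_apply, sub_apply, smul_apply, sum_apply, smul_eq_mul, delbar_toC, h3, h2]
  have h4 (γ : Fin n) : conjForm (θ γ.succ z) v = conj (θ γ.succ z v) := rfl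
  simp only [h4]
  linear_combination h1

/-- The last column of the connection, before the torsion is introduced. -/
lemma smoothConn_zero_apply (i : Fin (n + 1)) (v : Cn n) :
    smoothConn f ξ r W θ i 0 z v = -leviL f z (fullFrame ξ W i z) v
      + f z / (1 - r z * f z) * (conj (leviL f z (delbarG ξ z v) (fullFrame ξ W i z))
        - delG (toC r) z v * kron i 0) := by
  have h0 := D.one_sub_ne_zero hz
  have h1 := D.hess_sub_third hz v (fullFrame ξ W i z)
  rw [D.del_frame hz] at h1
  rw [← h1, smoothConn, add_apply, cForm_zero_apply, ContinuousLinearMap.coe_comp,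
    Function.comp_apply, D.coframe_zero hz, D.fderiv_frame_zero hz, hessL_comm (D.smooth z hz) v,
    thirdL_comm (D.smooth z hz) v]
  field_simp
  ring

lemma smoothConn_succ_zero (β : Fin n) :
    smoothConn f ξ r W θ β.succ 0 z =
      -(∑ γ : Fin n, leviMatrix f W z β γ • conjForm (θ γ.succ z))
        + (-(f z : ℂ) * lowerGrad r W β z / (1 - r z * f z)) • delG (toC f) z
        + ∑ γ : Fin n, (Complex.I * f z / (1 - r z * f z) *
            lowerTorsion f W (torsion ξ W θ) β γ z) • θ γ.succ z := by
  ext v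
  have h1 : conj (leviL f z (delbarG ξ z v) (W β z)) =
      -(delG (toC f) z v * lowerGrad r W β z)
        + ∑ γ : Fin n, θ γ.succ z v * (Complex.I * lowerTorsion f W (torsion ξ W θ) β γ z) := by
    simp only [← D.lowerTorsion_eq hz]
    conv_lhs => rw [D.eq_field_add_sum hz v]
    simp only [map_add, map_sum, delbarG_smul, add_apply, sum_apply, leviL_smul_left, map_mul,
      Complex.conj_conj, D.leviL_delbar_field_field hz, map_neg, mul_neg]
  rw [D.smoothConn_zero_apply hz, fullFrame_succ, h1, D.leviL_W_left hz]
  have h4 (γ : Fin n) : conjForm (θ γ.succ z) v = conj (θ γ.succ z v) := rfl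
  have h5 : (kron β.succ (0 : Fin (n + 1))) = 0 := by simp [kron]
  simp only [add_apply, sum_apply, smul_apply, neg_apply, smul_eq_mul, h4, h5, mul_zero, sub_zero,
    mul_add, Finset.mul_sum]
  rw [← add_assoc]
  congr 1
  · ring
  · exact Finset.sum_congr rfl fun _ _ => by ring

lemma smoothConn_zero_zero :
    smoothConn f ξ r W θ 0 0 z =
      -((r z : ℂ) • delbarG (toC f) z)
        + (-(f z : ℂ) * (r z : ℂ) ^ 2 / (1 - r z * f z)) • delG (toC f) z
        + (-(f z : ℂ) / (1 - r z * f z)) • delG (toC r) z := by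
  ext v
  have h5 : (kron (0 : Fin (n + 1)) 0) = 1 := by simp [kron]
  rw [D.smoothConn_zero_apply hz, fullFrame_zero, D.leviL_field_left hz, D.leviL_field_right hz,
    D.del_delbar_field hz, h5]
  simp only [add_apply, smul_apply, neg_apply, smul_eq_mul, map_mul, map_neg, Complex.conj_conj,
    Complex.conj_ofReal, delbar_toC]
  ring

end IsLocalFrame

/-! ### The Graham–Lee connection: existence and uniqueness -/

lemma wedge_apply (α β : OneCovector n) (u v : Cn n) :
    wedge α β u v = α u * β v - β u * α v := rfl

lemma conjForm_apply (α : OneCovector n) (v : Cn n) : conjForm α v = conj (α v) := rfl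

lemma fderiv_toC_apply (f : Cn n → ℝ) (z v : Cn n) :
    fderiv ℝ (toC f) z v = delG (toC f) z v + conj (delG (toC f) z v) := by
  rw [← delbar_toC, delG_add_delbarG]

lemma contactForm_apply (f : Cn n → ℝ) (z v : Cn n) :
    contactForm f z v =
      Complex.I / 2 * (conj (delG (toC f) z v) - delG (toC f) z v) := by
  rw [← delbar_toC]; rfl

lemma conj_contactForm (f : Cn n → ℝ) (z v : Cn n) :
    conj (contactForm f z v) = contactForm f z v := by
  simp only [contactForm_apply, map_mul, map_sub, map_div₀, Complex.conj_I, Complex.conj_conj,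
    Complex.conj_ofNat]
  ring

lemma sum_mul_kron {ι : Type*} [Fintype ι] [DecidableEq ι] (x : ι → ℂ) (j : ι) :
    ∑ i, x i * kron i j = x j := by simp [kron]

lemma sum_kron_mul {ι : Type*} [Fintype ι] [DecidableEq ι] (x : ι → ℂ) (i : ι) :
    ∑ j, kron i j * x j = x i := by simp [kron]

namespace IsLocalFrame

variable {f : Cn n → ℝ} {U : Set (Cn n)} {ξ : Cn n → Cn n} {r : Cn n → ℝ}
  {W : Fin n → Cn n → Cn n} {θ : Fin (n + 1) → Cn n → OneCovector n} {z : Cn n}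

variable (D : IsLocalFrame f U ξ r W θ) (hz : z ∈ U)
include D hz

lemma grahamLee_structure_eq (α : Fin n) :
    extd (θ α.succ) z =
      ∑ β : Fin n, wedge (θ β.succ z) (grahamLee f ξ r W θ β α z)
      - ∑ γ : Fin n, (Complex.I * torsion ξ W θ α γ z) •
          wedge (del (toC f) z) (conjForm (θ γ.succ z))
      - upperGrad f r W α z • wedge (del (toC f) z) (delbar (toC f) z)
      + ((1 / 2 : ℂ) * r z) • wedge (fderiv ℝ (toC f) z) (θ α.succ z) := by
  ext u v
  have hk (w w' : Cn n) : ∑ β : Fin n, θ β.succ z w *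
      (Complex.I * r z * kron β α * contactForm f z w') =
      Complex.I * r z * θ α.succ z w * contactForm f z w' := by
    rw [← sum_mul_kron (fun β : Fin n => Complex.I * r z * θ β.succ z w * contactForm f z w') α]
    exact Finset.sum_congr rfl fun _ _ => by ring
  have e : extd (θ α.succ) z u v =
      delG (toC f) z u * smoothConn f ξ r W θ 0 α.succ z v
      - smoothConn f ξ r W θ 0 α.succ z u * delG (toC f) z v
      + ∑ β : Fin n, wedge (θ β.succ z) (grahamLee f ξ r W θ β α z) u v
      + (Complex.I * r z * θ α.succ z u * contactForm f z v
        - Complex.I * r z * θ α.succ z v * contactForm f z u) := by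
    rw [D.extd_coframe hz, Fin.sum_univ_succ, D.coframe_zero hz]
    simp only [smoothConn_succ_succ, add_apply, sum_apply, wedge_apply, smul_apply, smul_eq_mul]
    rw [← hk, ← hk, add_assoc, ← Finset.sum_sub_distrib, ← Finset.sum_add_distrib]
    congr 1
    exact Finset.sum_congr rfl fun _ _ => by ring
  have es : ∑ γ : Fin n, (Complex.I * torsion ξ W θ α γ z) *
        (delG (toC f) z u * conj (θ γ.succ z v) - conj (θ γ.succ z u) * delG (toC f) z v) =
      delG (toC f) z u * ∑ γ : Fin n, (Complex.I * torsion ξ W θ α γ z) * conj (θ γ.succ z v)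
      - delG (toC f) z v * ∑ γ : Fin n, (Complex.I * torsion ξ W θ α γ z) *
        conj (θ γ.succ z u) := by
    rw [Finset.mul_sum, Finset.mul_sum, ← Finset.sum_sub_distrib]
    exact Finset.sum_congr rfl fun _ _ => by ring
  rw [e, D.smoothConn_zero_succ hz]
  simp only [add_apply, sub_apply, sum_apply, smul_apply, smul_eq_mul, del_eq_delG,
    delbar_eq_delbarG, conjForm_apply, delbar_toC, fderiv_toC_apply, contactForm_apply,
    wedge_apply, es]
  linear_combination (-(1 / 2 : ℂ) * r z * (θ α.succ z v * (conj (delG (toC f) z u)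
    - delG (toC f) z u) - θ α.succ z u * (conj (delG (toC f) z v) - delG (toC f) z v)))
    * Complex.I_mul_I

/-- Lowering the index of the connection forms. -/
lemma sum_leviMatrix_mul_grahamLee (α β : Fin n) (v : Cn n) :
    ∑ γ, leviMatrix f W z γ β * grahamLee f ξ r W θ α γ z v =
      leviL f z (fderiv ℝ (W α) z v) (W β z) + thirdL f z v (W α z) (W β z)
        - Complex.I * r z * contactForm f z v * leviMatrix f W z α β := by
  have h1 := D.sum_mul_leviMatrix hz (fun β => thirdL f z (W α z) v (W β z)) β
  rw [D.leviL_W_right hz, thirdL_comm (D.smooth z hz), ← h1,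
    ← sum_kron_mul (fun γ => Complex.I * r z * contactForm f z v * leviMatrix f W z γ β) α,
    ← Finset.sum_add_distrib, ← Finset.sum_sub_distrib]
  refine Finset.sum_congr rfl fun γ _ => ?_
  simp only [grahamLee, smoothConn, fullFrame_succ, sub_apply, add_apply, smul_apply, smul_eq_mul,
    ContinuousLinearMap.coe_comp, Function.comp_apply, cForm_succ_apply]
  ring

lemma grahamLee_metric (α β : Fin n) :
    fderiv ℝ (fun w => leviMatrix f W w α β) z =
      ∑ γ, leviMatrix f W z γ β • grahamLee f ξ r W θ α γ z
      + ∑ γ, leviMatrix f W z α γ • conjForm (grahamLee f ξ r W θ β γ z) := by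
  ext v
  have hf := D.smooth z hz
  have hherm (γ δ : Fin n) : conj (leviMatrix f W z γ δ) = leviMatrix f W z δ γ := by
    rw [D.leviMatrix_apply hz, D.leviMatrix_apply hz, leviL_conj hf]
  have e2 : ∑ γ, leviMatrix f W z α γ * conj (grahamLee f ξ r W θ β γ z v) =
      conj (∑ γ, leviMatrix f W z γ α * grahamLee f ξ r W θ β γ z v) := by
    simp only [map_sum, map_mul, hherm]
  have hL := (differentiableAt_of_smooth (contDiffAt_leviL hf)).hasFDerivAt
  have hW (γ : Fin n) := (differentiableAt_of_smooth (D.smooth_W hz γ)).hasFDerivAt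
  have hc : (fun y => leviMatrix f W y α β) =ᶠ[nhds z] fun y => leviL f y (W α y) (W β y) :=
    (D.eventually_mem hz).mono fun y hy => D.leviMatrix_apply hy α β
  rw [hc.fderiv_eq, ((hL.clm_apply (hW α)).clm_apply (hW β)).fderiv]
  simp only [add_apply, sum_apply, smul_apply, smul_eq_mul, conjForm_apply, e2,
    D.sum_leviMatrix_mul_grahamLee hz, map_add, map_sub, map_mul, Complex.conj_I,
    Complex.conj_ofReal, conj_contactForm, hherm, ContinuousLinearMap.coe_comp,
    Function.comp_apply, ContinuousLinearMap.flip_apply, fderiv_leviL (D.eventually_smooth hz),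
    leviL_conj hf]
  ring

/-- On vectors tangent to the level sets, the structure equation of the Graham–Lee connection is
that of the Tanaka–Webster connection. -/
lemma grahamLee_leaf (α : Fin n) {u v : Cn n} (hu : fderiv ℝ f z u = 0)
    (hv : fderiv ℝ f z v = 0) :
    extd (θ α.succ) z u v =
      (∑ β : Fin n, wedge (θ β.succ z) (grahamLee f ξ r W θ β α z)
      + ∑ γ : Fin n, torsion ξ W θ α γ z •
        wedge (contactForm f z) (conjForm (θ γ.succ z))) u v := by
  have ht (w : Cn n) (hw : fderiv ℝ f z w = 0) : conj (delG (toC f) z w) = -delG (toC f) z w := by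
    have h1 : fderiv ℝ (toC f) z w = (fderiv ℝ f z w : ℂ) := by
      have : toC f = Complex.ofRealCLM ∘ f := rfl
      rw [this, fderiv_comp z (Complex.ofRealCLM.differentiableAt)
        (differentiableAt_of_smooth (D.smooth z hz)), Complex.ofRealCLM.fderiv]
      rfl
    rw [hw, fderiv_toC_apply] at h1
    simp only [Complex.ofReal_zero] at h1
    linear_combination h1
  rw [D.grahamLee_structure_eq hz]
  simp only [add_apply, sub_apply, sum_apply, smul_apply, smul_eq_mul, del_eq_delG,
    delbar_eq_delbarG, conjForm_apply, delbar_toC, fderiv_toC_apply, contactForm_apply,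
    wedge_apply, ht u hu, ht v hv]
  have es : ∑ γ : Fin n, (Complex.I * torsion ξ W θ α γ z) *
        (delG (toC f) z u * conj (θ γ.succ z v) - conj (θ γ.succ z u) * delG (toC f) z v) =
      -∑ γ : Fin n, torsion ξ W θ α γ z *
        (Complex.I / 2 * (-delG (toC f) z u - delG (toC f) z u) * conj (θ γ.succ z v)
          - conj (θ γ.succ z u) * (Complex.I / 2 * (-delG (toC f) z v - delG (toC f) z v))) := by
    rw [← Finset.sum_neg_distrib]
    exact Finset.sum_congr rfl fun _ _ => by ring
  rw [es]
  ring

omit hz in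
lemma isGrahamLee :
    IsGrahamLee f U r W θ (grahamLee f ξ r W θ) (torsion ξ W θ) where
  smooth_forms _ _ _ hz := (D.smooth_grahamLee hz _ _).contDiffWithinAt
  smooth_torsion _ _ _ hz := (D.smooth_torsion hz _ _).contDiffWithinAt
  structure_eq α _ hz := D.grahamLee_structure_eq hz α
  metric α β _ hz := D.grahamLee_metric hz α β
  leaf α _ hz _ _ hu hv := D.grahamLee_leaf hz α hu hv

/-- Uniqueness: the structure equation determines the torsion and the `(0,1)`-parts of the connection
forms, and compatibility with the Levi form then determines the `(1,0)`-parts. -/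
lemma isGrahamLee_unique {φ φ' : Fin n → Fin n → Cn n → OneCovector n}
    {A A' : Fin n → Fin n → Cn n → ℂ} (h : IsGrahamLee f U r W θ φ A)
    (h' : IsGrahamLee f U r W θ φ' A') (α β : Fin n) :
    φ' α β z = φ α β z ∧ A' α β z = A α β z := by
  have hcoW (β γ : Fin n) : θ β.succ z (W γ z) = kron β γ := by
    have := D.coframe_frame hz β.succ γ.succ
    rw [fullFrame_succ] at this
    rw [this]
    simp [kron]
  have hcoξ (β : Fin n) : θ β.succ z (ξ z) = 0 := by
    have := D.coframe_frame hz β.succ 0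
    rw [fullFrame_zero] at this
    rw [this]
    simp [kron]
  -- the difference of the structure equations
  have hs (α : Fin n) (u v : Cn n) :
      ∑ β : Fin n, (θ β.succ z u * (φ' β α z v - φ β α z v)
        - (φ' β α z u - φ β α z u) * θ β.succ z v)
      = ∑ γ : Fin n, Complex.I * (A' α γ z - A α γ z) * (delG (toC f) z u * conj (θ γ.succ z v)
        - conj (θ γ.succ z u) * delG (toC f) z v) := by
    have e := DFunLike.congr_fun (DFunLike.congr_fun
      ((h'.structure_eq α z hz).symm.trans (h.structure_eq α z hz)) u) v
    simp only [add_apply, sub_apply, sum_apply, smul_apply, smul_eq_mul, del_eq_delG,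
      conjForm_apply, wedge_apply] at e
    simp only [mul_sub, sub_mul, Finset.sum_sub_distrib] at e ⊢
    linear_combination e
  -- contraction with the antilinear part in the first argument
  have hs01 (α : Fin n) (u v : Cn n) :
      ∑ β : Fin n, part01 (φ' β α z - φ β α z) u * θ β.succ z v
      = ∑ γ : Fin n, Complex.I * (A' α γ z - A α γ z) *
          (conj (θ γ.succ z u) * delG (toC f) z v) := by
    have e1 := hs α u v
    have e2 := hs α (Complex.I • u) v
    simp only [D.coframe_smul hz, delG_smul, smul_eq_mul, map_mul, Complex.conj_I] at e2
    have e3 : ∑ β : Fin n, part01 (φ' β α z - φ β α z) u * θ β.succ z v =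
        -(1 / 2 : ℂ) * ∑ β : Fin n, (θ β.succ z u * (φ' β α z v - φ β α z v)
          - (φ' β α z u - φ β α z u) * θ β.succ z v)
        - (1 / 2 : ℂ) * Complex.I * ∑ β : Fin n,
          (Complex.I * θ β.succ z u * (φ' β α z v - φ β α z v)
          - (φ' β α z (Complex.I • u) - φ β α z (Complex.I • u)) * θ β.succ z v) := by
      rw [Finset.mul_sum, Finset.mul_sum, ← Finset.sum_sub_distrib]
      refine Finset.sum_congr rfl fun β _ => ?_
      simp only [part01_apply, sub_apply, smul_eq_mul]
      linear_combination (1 / 2 : ℂ) * θ β.succ z u * (φ' β α z v - φ β α z v)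
        * Complex.I_mul_I
    rw [e3, e1, e2, Finset.mul_sum, Finset.mul_sum, ← Finset.sum_sub_distrib]
    refine Finset.sum_congr rfl fun γ _ => ?_
    linear_combination (-(1 / 2 : ℂ) * Complex.I * (A' α γ z - A α γ z)
      * (delG (toC f) z u * conj (θ γ.succ z v) + conj (θ γ.succ z u) * delG (toC f) z v))
      * Complex.I_mul_I
  have h01 (β α : Fin n) (u : Cn n) : part01 (φ' β α z - φ β α z) u = 0 := by
    have := hs01 α u (W β z)
    simpa only [hcoW, D.del_W hz, mul_zero, Finset.sum_const_zero, sum_mul_kron] using this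
  have hA : A' α β z = A α β z := by
    have := hs01 α (W β z) (ξ z)
    simp only [hcoξ, hcoW, D.del_field hz, mul_zero, Finset.sum_const_zero, mul_one] at this
    have hk (γ : Fin n) : conj (kron γ β : ℂ) = kron γ β := by
      simp only [kron]; split_ifs <;> simp
    simp only [hk, sum_mul_kron] at this
    have h2 := (mul_eq_zero.1 this.symm).resolve_left Complex.I_ne_zero
    exact sub_eq_zero.1 h2
  refine ⟨?_, hA⟩
  have hm (α β : Fin n) (u : Cn n) :
      ∑ γ, leviMatrix f W z γ β * (φ' α γ z u - φ α γ z u)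
        + ∑ γ, leviMatrix f W z α γ * conj (φ' β γ z u - φ β γ z u) = 0 := by
    have e := DFunLike.congr_fun ((h'.metric α β z hz).symm.trans (h.metric α β z hz)) u
    simp only [add_apply, sum_apply, smul_apply, smul_eq_mul, conjForm_apply] at e
    simp only [map_sub, mul_sub, Finset.sum_sub_distrib]
    linear_combination e
  have hI (α β : Fin n) (u : Cn n) : φ' α β z (Complex.I • u) - φ α β z (Complex.I • u) =
      Complex.I * (φ' α β z u - φ α β z u) := by
    have := h01 α β u
    simp only [part01_apply, sub_apply, smul_eq_mul] at this
    linear_combination -2 * Complex.I * this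
      + (φ' α β z (Complex.I • u) - φ α β z (Complex.I • u)) * Complex.I_mul_I
  have hzero (α β : Fin n) (u : Cn n) :
      ∑ γ, (φ' α γ z u - φ α γ z u) * leviMatrix f W z γ β = 0 := by
    have e1 := hm α β u
    have e2 := hm α β (Complex.I • u)
    simp only [hI, map_mul, Complex.conj_I] at e2
    have a1 : ∑ γ, leviMatrix f W z γ β * (Complex.I * (φ' α γ z u - φ α γ z u)) =
        Complex.I * ∑ γ, leviMatrix f W z γ β * (φ' α γ z u - φ α γ z u) := by
      rw [Finset.mul_sum]; exact Finset.sum_congr rfl fun _ _ => by ring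
    have a2 : ∑ γ, leviMatrix f W z α γ * (-Complex.I * conj (φ' β γ z u - φ β γ z u)) =
        -Complex.I * ∑ γ, leviMatrix f W z α γ * conj (φ' β γ z u - φ β γ z u) := by
      rw [Finset.mul_sum]; exact Finset.sum_congr rfl fun _ _ => by ring
    rw [a1, a2] at e2
    simp only [mul_comm _ (leviMatrix f W z _ β)]
    set S := ∑ γ, leviMatrix f W z γ β * (φ' α γ z u - φ α γ z u)
    set S' := ∑ γ, leviMatrix f W z α γ * conj (φ' β γ z u - φ β γ z u)
    linear_combination (1 / 2 : ℂ) * e1 - (1 / 2 : ℂ) * Complex.I * e2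
      + (1 / 2 : ℂ) * (S - S') * Complex.I_mul_I
  ext u
  have hv := Matrix.eq_zero_of_vecMul_eq_zero (D.isUnit_det hz).ne_zero
    (v := fun γ => φ' α γ z u - φ α γ z u) (funext fun β => hzero α β u)
  exact sub_eq_zero.1 (congrFun hv β)

end IsLocalFrame

/-! ### The metric `∂∂̄ log(-1/f)` and its Chern connection -/

/-- The function `σ = 1/(-f)`, in terms of which `∂∂̄ log(-1/f) = σ ∂∂̄f + σ² ∂f ∧ ∂̄f`. -/
def negInv (f : Cn n → ℝ) (z : Cn n) : ℂ := 1 / (-(f z : ℂ))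

/-- The metric `∂∂̄ log(-1/f)` as a field of sesquilinear forms. -/
def logMetric (f : Cn n → ℝ) (z : Cn n) : Cn n →L[ℝ] Cn n →L[ℝ] ℂ :=
  negInv f z • leviL f z + (negInv f z * negInv f z) •
    (delG (toC f) z).smulRight (delbarG (toC f) z)

section

variable {f : Cn n → ℝ} {z : Cn n}

lemma logMetric_apply (f : Cn n → ℝ) (z v w : Cn n) :
    logMetric f z v w = negInv f z * leviL f z v w
      + negInv f z * negInv f z * (delG (toC f) z v * conj (delG (toC f) z w)) := by
  rw [← delbar_toC]; rfl

lemma negInv_mul (h0 : f z ≠ 0) : negInv f z * f z = -1 := by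
  have : (f z : ℂ) ≠ 0 := by exact_mod_cast h0
  rw [negInv]; field_simp

lemma negInv_ne_zero (h0 : f z ≠ 0) : negInv f z ≠ 0 := by
  intro h
  have := negInv_mul h0
  rw [h] at this
  simp at this

lemma contDiffAt_negInv (h : ContDiffAt ℝ ∞ f z) (h0 : f z ≠ 0) :
    ContDiffAt ℝ ∞ (negInv f) z := by
  have : (-(f z : ℂ)) ≠ 0 := by simpa using h0
  have h1 : ContDiffAt ℝ ∞ (fun y => (-(f y : ℂ))⁻¹) z := (contDiffAt_toC h).neg.inv this
  exact h1.congr_of_eventuallyEq (.of_forall fun y => by simp [negInv])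

lemma fderiv_negInv (h : ContDiffAt ℝ ∞ f z) (h0 : f z ≠ 0) (v : Cn n) :
    fderiv ℝ (negInv f) z v = negInv f z * negInv f z * fderiv ℝ (toC f) z v := by
  have hd := differentiableAt_of_smooth (contDiffAt_toC h)
  have hs := differentiableAt_of_smooth (contDiffAt_negInv h h0)
  have hc : (fun y => negInv f y * toC f y) =ᶠ[nhds z] fun _ => -1 := by
    filter_upwards [h.continuousAt.eventually_ne h0] with y hy using negInv_mul hy
  have e := DFunLike.congr_fun
    ((hs.hasFDerivAt.mul hd.hasFDerivAt).fderiv.symm.trans hc.fderiv_eq) v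
  simp only [add_apply, smul_apply, smul_eq_mul, fderiv_fun_const, Pi.zero_apply,
    zero_apply] at e
  have e' := negInv_mul h0
  rw [show toC f z = (f z : ℂ) from rfl] at e
  linear_combination -negInv f z * e + fderiv ℝ (negInv f) z v * e'

lemma delG_negInv (h : ContDiffAt ℝ ∞ f z) (h0 : f z ≠ 0) (v : Cn n) :
    delG (negInv f) z v = negInv f z * negInv f z * delG (toC f) z v := by
  simp only [delG, part10_apply, fderiv_negInv h h0, smul_eq_mul]
  ring

lemma delG_mul {a b : Cn n → ℂ} (ha : DifferentiableAt ℝ a z) (hb : DifferentiableAt ℝ b z)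
    (v : Cn n) : delG (fun y => a y * b y) z v = delG a z v * b z + a z * delG b z v := by
  have e := (ha.hasFDerivAt.mul hb.hasFDerivAt).fderiv
  have e' (v : Cn n) : fderiv ℝ (fun y => a y * b y) z v =
      a z * fderiv ℝ b z v + b z * fderiv ℝ a z v := DFunLike.congr_fun e v
  simp only [delG, part10_apply, e', smul_eq_mul]
  ring

lemma delG_add {a b : Cn n → ℂ} (ha : DifferentiableAt ℝ a z) (hb : DifferentiableAt ℝ b z)
    (v : Cn n) : delG (fun y => a y + b y) z v = delG a z v + delG b z v := by
  simp only [delG, part10_apply, fderiv_fun_add ha hb, add_apply, smul_eq_mul]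
  ring

/-- `∂∂̄ log(-1/f) = σ ∂∂̄f + σ² ∂f ∧ ∂̄f` with `σ = -1/f`. -/
lemma levi_log (h : ∀ᶠ y in nhds z, ContDiffAt ℝ ∞ f y) (h0 : f z ≠ 0) (v w : Cn n) :
    levi (toC fun y => Real.log (-1 / f y)) z v w = logMetric f z v w := by
  have hz := h.self_of_nhds
  have hq : (toC fun y => Real.log (-1 / f y)) = toC fun y => -Real.log (f y) := by
    funext y
    simp only [toC, neg_div, Real.log_neg_eq_log, one_div, Real.log_inv]
  have hd : ∀ᶠ y in nhds z, delbarG (toC fun y => -Real.log (f y)) y w =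
      negInv f y * delbarG (toC f) y w := by
    filter_upwards [h, hz.continuousAt.eventually_ne h0] with y hy hy0
    have hfy := (differentiableAt_of_smooth hy).hasFDerivAt
    have e (u : Cn n) : fderiv ℝ (toC fun y => -Real.log (f y)) y u =
        negInv f y * fderiv ℝ (toC f) y u := by
      have h1 : HasFDerivAt (toC fun y => -Real.log (f y))
          (Complex.ofRealCLM.comp (-((f y)⁻¹ • fderiv ℝ f y))) y :=
        Complex.ofRealCLM.hasFDerivAt.comp y (hfy.log hy0).neg
      have h2 : HasFDerivAt (toC f) (Complex.ofRealCLM.comp (fderiv ℝ f y)) y :=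
        Complex.ofRealCLM.hasFDerivAt.comp y hfy
      rw [h1.fderiv, h2.fderiv]
      simp [negInv]
    simp only [delbarG, part01_apply, e, smul_eq_mul]
    ring
  have hdb := differentiableAt_of_smooth (contDiffAt_delbarG (contDiffAt_toC hz))
  rw [levi, del_eq_delG, delbar_eq_delbarG, hq]
  have e1 : delG (fun y => delbarG (toC fun y => -Real.log (f y)) y w) z v =
      delG (fun y => negInv f y * delbarG (toC f) y w) z v := by
    simp only [delG, Filter.EventuallyEq.fderiv_eq hd]
  rw [e1, delG_mul (differentiableAt_of_smooth (contDiffAt_negInv hz h0))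
    (hdb.clm_apply (differentiableAt_const w)), delG_negInv hz h0, delG_eval hdb, delbar_toC,
    logMetric_apply, leviL]
  ring

lemma delG_logMetric (h : ∀ᶠ y in nhds z, ContDiffAt ℝ ∞ f y) (h0 : f z ≠ 0) (v u w : Cn n) :
    delG (fun y => logMetric f y u w) z v =
      negInv f z * thirdL f z v u w
      + negInv f z * negInv f z * (delG (toC f) z v * leviL f z u w
        + hessL f z v u * conj (delG (toC f) z w) + delG (toC f) z u * leviL f z v w)
      + 2 * negInv f z * negInv f z * negInv f z *
        (delG (toC f) z v * delG (toC f) z u * conj (delG (toC f) z w)) := by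
  have hz := h.self_of_nhds
  have hs := differentiableAt_of_smooth (contDiffAt_negInv hz h0)
  have hp := differentiableAt_of_smooth (contDiffAt_delG (contDiffAt_toC hz))
  have hb := differentiableAt_of_smooth (contDiffAt_delbarG (contDiffAt_toC hz))
  have hL := differentiableAt_of_smooth (contDiffAt_leviL hz)
  have hpu := hp.clm_apply (differentiableAt_const u)
  have hbw := hb.clm_apply (differentiableAt_const w)
  have hLu := hL.clm_apply (differentiableAt_const u)
  have hLuw := hLu.clm_apply (differentiableAt_const w)
  have e : (fun y => logMetric f y u w) = fun y => negInv f y * leviL f y u w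
      + negInv f y * negInv f y * (delG (toC f) y u * delbarG (toC f) y w) := rfl
  rw [e, delG_add (hs.fun_mul hLuw) ((hs.fun_mul hs).fun_mul (hpu.fun_mul hbw)),
    delG_mul hs hLuw, delG_mul (hs.fun_mul hs) (hpu.fun_mul hbw), delG_mul hs hs, delG_mul hpu hbw, delG_negInv hz h0,
    delG_eval hp, delG_eval hb, delG_eval hLu, delG_eval hL, delbar_toC, thirdL, hessL]
  rw [show delG (delbarG (toC f)) z v w = leviL f z v w from rfl]
  ring

lemma logMetric_smul_right (h : ContDiffAt ℝ ∞ f z) (c : ℂ) (v w : Cn n) :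
    logMetric f z v (c • w) = conj c * logMetric f z v w := by
  simp only [logMetric_apply, leviL_smul_right h, delG_smul, smul_eq_mul, map_mul]
  ring

lemma logMetric_smul_left (c : ℂ) (v w : Cn n) :
    logMetric f z (c • v) w = c * logMetric f z v w := by
  simp only [logMetric_apply, leviL_smul_left, delG_smul, smul_eq_mul]
  ring

end

lemma sum_sum_coord {Q : Cn n →L[ℝ] Cn n →L[ℝ] ℂ} (hl : ∀ (c : ℂ) v w, Q (c • v) w = c * Q v w)
    (hr : ∀ (c : ℂ) v w, Q v (c • w) = conj c * Q v w) (v w : Cn n) :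
    ∑ a, ∑ b, v a * conj (w b) * Q (coordVec a) (coordVec b) = Q v w := by
  conv_rhs => rw [← sum_coordVec v, ← sum_coordVec w]
  simp only [map_sum, sum_apply, hr]
  rw [Finset.sum_comm]
  refine Finset.sum_congr rfl fun b _ => ?_
  exact Finset.sum_congr rfl fun a _ => by rw [hl]; ring

namespace IsLocalFrame

variable {f : Cn n → ℝ} {U : Set (Cn n)} {ξ : Cn n → Cn n} {r : Cn n → ℝ}
  {W : Fin n → Cn n → Cn n} {θ : Fin (n + 1) → Cn n → OneCovector n} {z : Cn n}
  {G : Cn n → Matrix (Fin (n + 1)) (Fin (n + 1)) ℂ}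

variable (D : IsLocalFrame f U ξ r W θ) (hz : z ∈ U)
include D hz

/-- The metric is nondegenerate where `1 - r f > 0`. -/
lemma logMetric_nondegenerate (h0 : f z < 0) {u : Cn n} (h : ∀ w, logMetric f z u w = 0) :
    u = 0 := by
  have hs := negInv_ne_zero h0.ne
  have hm := negInv_mul h0.ne
  have hp : delG (toC f) z u = 0 := by
    have h1 := h (ξ z)
    rw [logMetric_apply, D.leviL_field_right hz, D.del_field hz, map_one] at h1
    have h2 : (negInv f z * negInv f z * (1 - r z * f z)) * delG (toC f) z u = 0 := by
      linear_combination h1 - negInv f z * r z * delG (toC f) z u * hm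
    exact (mul_eq_zero.1 h2).resolve_left
      (mul_ne_zero (mul_ne_zero hs hs) (D.one_sub_ne_zero hz))
  by_contra hu
  have h1 := h u
  rw [logMetric_apply, hp, zero_mul, mul_zero, add_zero] at h1
  have h2 := (mul_eq_zero.1 h1).resolve_left hs
  have h3 := (D.strict z hz).2 u hu hp
  rw [h2] at h3
  simp at h3

/-- A vector `X` satisfying the equations that define the tensor `C` has the components of `C`. -/
lemma coframe_eq_cForm {X u v : Cn n}
    (h0 : delG (toC f) z X * (1 - r z * f z) = hessL f z u v - f z * thirdL f z u v (ξ z))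
    (h1 : ∀ β, leviL f z X (W β z) = thirdL f z u v (W β z)) (j : Fin (n + 1)) :
    θ j z X = cForm f ξ r W j z u v := by
  refine Fin.cases ?_ (fun α => ?_) j
  · have := D.one_sub_ne_zero hz
    rw [D.coframe_zero hz, cForm_zero_apply, ← h0]
    field_simp
  · rw [D.coframe_succ hz, cForm_succ_apply]
    simp only [h1]

lemma Yform_eq (i j : Fin (n + 1)) :
    Yform f (fullFrame ξ W) θ i j z =
      negInv f z • ((kron i j : ℂ) • delG (toC f) z + (kron i 0 : ℂ) • θ j z) := by
  ext v
  simp only [Yform, del_eq_delG, D.del_frame hz, smul_apply, sum_apply, add_apply, smul_eq_mul,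
    add_mul, Finset.sum_add_distrib, negInv]
  congr 2
  · have : ∀ k : Fin (n + 1), kron i j * kron k 0 * θ k z v =
        kron i j * θ k z v * kron k 0 := fun k => by ring
    simp only [this, sum_mul_kron, D.coframe_zero hz]
  · have : ∀ k : Fin (n + 1), kron k j * kron i 0 * θ k z v =
        kron i 0 * θ k z v * kron k j := fun k => by ring
    simp only [this, sum_mul_kron]

/-- The Chern connection of `∂∂̄ log(-1/f)`. Its difference `X` from the flat connection is
characterized by `g(X, w) = (∂_v g)(F_i, w)`; removing the pole terms `σ (∂f(v) F_i + ∂f(F_i) v)`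
leaves the equations that define `C`. -/
lemma psi_eq (h0 : f z < 0)
    (hG : ∀ᶠ y in nhds z, ∀ a b, G y a b = logMetric f y (coordVec a) (coordVec b))
    (i j : Fin (n + 1)) :
    psi G (fullFrame ξ W) θ i j z =
      smoothConn f ξ r W θ i j z + Yform f (fullFrame ξ W) θ i j z := by
  have hf := D.smooth z hz
  have hev := D.eventually_smooth hz
  have hs := negInv_ne_zero h0.ne
  have hm := negInv_mul h0.ne
  set F := fullFrame ξ W i z with hF
  ext v
  -- the vector `X` with components `F^a Γ_a^b(v)`
  set x : Fin (n + 1) → ℂ := fun b => ∑ a, F a * chernCoord G a b z v with hx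
  set X : Cn n := ∑ b, x b • coordVec b with hX
  have hpsi : psi G (fullFrame ξ W) θ i j z v =
      θ j z (fderiv ℝ (fullFrame ξ W i) z v) + θ j z X := by
    have : θ j z X = ∑ b, x b * θ j z (coordVec b) := by
      rw [hX, map_sum]
      exact Finset.sum_congr rfl fun b _ => D.coframe_smul hz j _ _
    rw [this]
    simp only [psi, add_apply, sum_apply, smul_apply, smul_eq_mul, ContinuousLinearMap.coe_comp,
      Function.comp_apply, hx, Finset.sum_mul]
    rw [Finset.sum_comm]
    congr 1
    exact Finset.sum_congr rfl fun b _ => Finset.sum_congr rfl fun a _ => by rw [← hF]; ring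
  have hGz := hG.self_of_nhds
  have hdet : IsUnit (G z).det := by
    rw [isUnit_iff_ne_zero]
    intro hd
    obtain ⟨y, hy0, hy⟩ := Matrix.exists_vecMul_eq_zero_iff.2 hd
    have hu : (∑ a, y a • coordVec a : Cn n) = 0 := by
      refine D.logMetric_nondegenerate hz h0 fun w => ?_
      rw [← sum_coordVec w, map_sum]
      refine Finset.sum_eq_zero fun b _ => ?_
      rw [logMetric_smul_right hf]
      have h1 := congrFun hy b
      simp only [Matrix.vecMul, dotProduct, Pi.zero_apply, hGz] at h1
      simp only [map_sum, sum_apply, logMetric_smul_left, h1, mul_zero]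
    refine hy0 (funext fun a => ?_)
    have := congrArg (fun v : Cn n => v a) hu
    simpa [coordVec, Pi.single_apply] using this
  have hgX (w : Cn n) : logMetric f z X w = delG (fun y => logMetric f y F w) z v := by
    have hd (a b : Fin (n + 1)) : del (fun y => G y a b) z v =
        delG (fun y => logMetric f y (coordVec a) (coordVec b)) z v := by
      have : (fun y => G y a b) =ᶠ[nhds z] fun y => logMetric f y (coordVec a) (coordVec b) :=
        hG.mono fun y hy => hy a b
      simp only [del_eq_delG, delG, this.fderiv_eq]
    have hcoord (d : Fin (n + 1)) : logMetric f z X (coordVec d) =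
        ∑ a, F a * delG (fun y => logMetric f y (coordVec a) (coordVec d)) z v := by
      have hinv := Matrix.nonsing_inv_mul _ hdet
      have hk (c : Fin (n + 1)) : ∑ b, (G z)⁻¹ c b * G z b d = if c = d then 1 else 0 := by
        rw [← Matrix.mul_apply, hinv, Matrix.one_apply]
      have h1 : logMetric f z X (coordVec d) = ∑ b, x b * G z b d := by
        rw [hX, map_sum, sum_apply]
        exact Finset.sum_congr rfl fun b _ => by rw [logMetric_smul_left, hGz]
      have h2 (a : Fin (n + 1)) : ∑ b, chernCoord G a b z v * G z b d =
          del (fun y => G y a d) z v := by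
        calc _ = ∑ c, del (fun y => G y a c) z v * ∑ b, (G z)⁻¹ c b * G z b d := by
              simp only [chernCoord, sum_apply, smul_apply, smul_eq_mul, Finset.sum_mul,
                Finset.mul_sum]
              rw [Finset.sum_comm]
              exact Finset.sum_congr rfl fun _ _ => Finset.sum_congr rfl fun _ _ => by ring
          _ = _ := by simp only [hk, mul_ite, mul_one, mul_zero, Finset.sum_ite_eq',
              Finset.mem_univ, if_true]
      rw [h1]
      simp only [hx, Finset.sum_mul, ← hd, ← h2, Finset.mul_sum]
      rw [Finset.sum_comm]
      exact Finset.sum_congr rfl fun _ _ => Finset.sum_congr rfl fun _ _ => by ring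
    have hQ (u w : Cn n) := delG_logMetric hev h0.ne v u w
    -- both sides are antilinear in `w`
    have hcoord' (d : Fin (n + 1)) : logMetric f z X (coordVec d) =
        delG (fun y => logMetric f y F (coordVec d)) z v := by
      have e : F = ∑ a, F a • coordVec a := (sum_coordVec F).symm
      rw [hcoord, hQ]
      conv_rhs => rw [e]
      simp only [hQ, map_sum, sum_apply, thirdL_smul_mid hf, leviL_smul_left, hessL_smul_right hf,
        delG_smul, smul_eq_mul, Finset.mul_sum, Finset.sum_mul, ← Finset.sum_add_distrib]
      exact Finset.sum_congr rfl fun _ _ => by ring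
    rw [hQ]
    have e : w = ∑ a, w a • coordVec a := (sum_coordVec w).symm
    rw [e]
    simp only [map_sum, logMetric_smul_right hf, hcoord', hQ, thirdL_smul_right hev,
      leviL_smul_right hf, delG_smul, smul_eq_mul, map_mul, Finset.mul_sum,
      ← Finset.sum_add_distrib]
    exact Finset.sum_congr rfl fun _ _ => by ring
  -- removal of the pole terms
  set X' : Cn n := X - negInv f z • (delG (toC f) z v • F + delG (toC f) z F • v) with hX'
  have hgX' (w : Cn n) : logMetric f z X' w = negInv f z * thirdL f z v F w
      + negInv f z * negInv f z * hessL f z v F * conj (delG (toC f) z w) := by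
    rw [hX', map_sub, sub_apply, logMetric_smul_left, map_add, add_apply, logMetric_smul_left,
      logMetric_smul_left, hgX, delG_logMetric hev h0.ne]
    simp only [logMetric_apply]
    ring
  have hp : delG (toC f) z X' * (1 - r z * f z) =
      hessL f z F v - f z * thirdL f z F v (ξ z) := by
    have h1 := hgX' (ξ z)
    rw [logMetric_apply, D.leviL_field_right hz, D.del_field hz, map_one] at h1
    refine mul_left_cancel₀ (mul_ne_zero hs hs) ?_
    rw [hessL_comm hf F v, thirdL_comm hf F v]
    linear_combination h1 + (negInv f z * thirdL f z v F (ξ z)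
      - negInv f z * r z * delG (toC f) z X') * hm
  have hW (β : Fin n) : leviL f z X' (W β z) = thirdL f z F v (W β z) := by
    have h1 := hgX' (W β z)
    rw [logMetric_apply, D.del_W hz, map_zero, mul_zero, mul_zero, mul_zero, add_zero,
      add_zero] at h1
    rw [thirdL_comm hf F v]
    exact mul_left_cancel₀ hs h1
  have hC := D.coframe_eq_cForm hz hp hW j
  have hXX : θ j z X = θ j z X' + negInv f z * (delG (toC f) z v * kron j i
      + kron i 0 * θ j z v) := by
    rw [hX', map_sub, D.coframe_smul hz, map_add, D.coframe_smul hz, D.coframe_smul hz, hF,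
      D.coframe_frame hz, D.del_frame hz]
    ring
  have hk : (kron j i : ℂ) = kron i j := by simp only [kron, eq_comm]
  rw [hpsi, hXX, hC, D.Yform_eq hz, smoothConn, hk]
  simp only [add_apply, smul_apply, smul_eq_mul, ContinuousLinearMap.coe_comp,
    Function.comp_apply]
  ring

/-- On the side `f < 0` the renormalized connection is the smooth one. -/
lemma renConn_eq (h0 : f z < 0)
    (hG : ∀ᶠ y in nhds z, ∀ a b, G y a b = logMetric f y (coordVec a) (coordVec b))
    (i j : Fin (n + 1)) :
    renConn f G (fullFrame ξ W) θ i j z = smoothConn f ξ r W θ i j z := by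
  rw [renConn, D.psi_eq hz h0 hG, add_sub_cancel_right]

end IsLocalFrame

/-! ### Curvature -/

section

variable {z : Cn n}

lemma extd_congr {α β : Cn n → OneCovector n} (h : α =ᶠ[nhds z] β) : extd α z = extd β z := by
  rw [extd, extd, h.fderiv_eq]

lemma extd_add {α β : Cn n → OneCovector n} (hα : DifferentiableAt ℝ α z)
    (hβ : DifferentiableAt ℝ β z) :
    extd (fun y => α y + β y) z = extd α z + extd β z := by
  ext u v
  simp only [extd, fderiv_fun_add hα hβ, sub_apply, add_apply, ContinuousLinearMap.flip_apply]
  ring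

lemma extd_smul {c : Cn n → ℂ} {α : Cn n → OneCovector n} (hc : DifferentiableAt ℝ c z)
    (hα : DifferentiableAt ℝ α z) (u v : Cn n) :
    extd (fun y => c y • α y) z u v =
      fderiv ℝ c z u * α z v - fderiv ℝ c z v * α z u + c z * extd α z u v := by
  have e := (hc.hasFDerivAt.smul hα.hasFDerivAt).fderiv
  have e' (u : Cn n) : fderiv ℝ (fun y => c y • α y) z u =
      c z • fderiv ℝ α z u + fderiv ℝ c z u • α z := DFunLike.congr_fun e u
  simp only [extd, sub_apply, ContinuousLinearMap.flip_apply, e', add_apply, smul_apply,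
    smul_eq_mul]
  ring

lemma extd_const_smul {α : Cn n → OneCovector n} (hα : DifferentiableAt ℝ α z) (c : ℂ) :
    extd (fun y => c • α y) z = c • extd α z := by
  ext u v
  rw [extd_smul (differentiableAt_const c) hα]
  simp

lemma curv_congr {η η' : Fin (n + 1) → Fin (n + 1) → Cn n → OneCovector n}
    (h : ∀ i j, η i j =ᶠ[nhds z] η' i j) (i j : Fin (n + 1)) : curv η i j z = curv η' i j z := by
  simp only [curv, extd_congr (h i j), (h _ _).self_of_nhds]

/-- The curvature of the sum of a connection and a matrix of forms. -/
lemma curv_add {η Y : Fin (n + 1) → Fin (n + 1) → Cn n → OneCovector n}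
    (hη : ∀ i j, DifferentiableAt ℝ (η i j) z) (hY : ∀ i j, DifferentiableAt ℝ (Y i j) z)
    (i j : Fin (n + 1)) (u v : Cn n) :
    curv (fun i j y => η i j y + Y i j y) i j z u v =
      curv η i j z u v + extd (Y i j) z u v
      - ∑ k, (η i k z u * Y k j z v - Y k j z u * η i k z v)
      - ∑ k, (Y i k z u * η k j z v - η k j z u * Y i k z v)
      - ∑ k, (Y i k z u * Y k j z v - Y k j z u * Y i k z v) := by
  rw [curv, curv, extd_add (hη i j) (hY i j)]
  simp only [sub_apply, add_apply, sum_apply, wedge_apply, add_mul, mul_add,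
    Finset.sum_add_distrib, Finset.sum_sub_distrib]
  ring

lemma contDiffAt_wedge {α β : Cn n → OneCovector n} (hα : ContDiffAt ℝ ∞ α z)
    (hβ : ContDiffAt ℝ ∞ β z) : ContDiffAt ℝ ∞ (fun y => wedge (α y) (β y)) z := by
  have h {α β : Cn n → OneCovector n} (hα : ContDiffAt ℝ ∞ α z) (hβ : ContDiffAt ℝ ∞ β z) :
      ContDiffAt ℝ ∞ (fun y => (α y).smulRight (β y)) z := by
    have e : (fun y => (α y).smulRight (β y)) = fun y =>
        ((ContinuousLinearMap.lsmul ℝ ℂ : ℂ →L[ℝ] OneCovector n →L[ℝ] OneCovector n).flip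
          (β y)).comp (α y) := rfl
    rw [e]
    exact (contDiffAt_const.clm_apply hβ).clm_comp hα
  exact (h hα hβ).sub (h hβ hα)

lemma contDiffAt_extd {α : Cn n → OneCovector n} (hα : ContDiffAt ℝ ∞ α z) :
    ContDiffAt ℝ ∞ (extd α) z :=
  (contDiffAt_fderiv hα).sub
    ((ContinuousLinearMap.flipₗᵢ ℝ (Cn n) (Cn n) ℂ).contDiff.contDiffAt.comp z
      (contDiffAt_fderiv hα))

lemma contDiffAt_curv {η : Fin (n + 1) → Fin (n + 1) → Cn n → OneCovector n}
    (h : ∀ i j, ContDiffAt ℝ ∞ (η i j) z) (i j : Fin (n + 1)) :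
    ContDiffAt ℝ ∞ (curv η i j) z :=
  (contDiffAt_extd (h i j)).sub (ContDiffAt.sum fun k _ => contDiffAt_wedge (h i k) (h k j))

/-- `d∂f = ∂̄∂f`. -/
lemma extd_del {f : Cn n → ℝ} (h : ContDiffAt ℝ ∞ f z) (u v : Cn n) :
    extd (delG (toC f)) z u v = leviL f z v u - leviL f z u v := by
  simp only [extd, sub_apply, ContinuousLinearMap.flip_apply, fderiv_del h, hessL_comm h v u]
  ring

end

namespace IsLocalFrame

variable {f : Cn n → ℝ} {U : Set (Cn n)} {ξ : Cn n → Cn n} {r : Cn n → ℝ}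
  {W : Fin n → Cn n → Cn n} {θ : Fin (n + 1) → Cn n → OneCovector n} {z : Cn n}
  {G : Cn n → Matrix (Fin (n + 1)) (Fin (n + 1)) ℂ}

variable (D : IsLocalFrame f U ξ r W θ) (hz : z ∈ U)
include D hz

/-- The form `-f u_i` is the `(1,0)`-part of the last column of the renormalized connection. -/
lemma smoothConn_eq_uForm (i : Fin (n + 1)) (v : Cn n) :
    smoothConn f ξ r W θ i 0 z v = -leviL f z (fullFrame ξ W i z) v
      - f z * uForm f r W θ (torsion ξ W θ) i z v := by
  refine Fin.cases ?_ (fun β => ?_) i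
  · rw [D.smoothConn_zero_zero hz, fullFrame_zero, D.leviL_field_left hz]
    simp only [uForm, Fin.cases_zero, add_apply, neg_apply, smul_apply, smul_eq_mul, delbar_toC,
      del_eq_delG]
    ring
  · rw [D.smoothConn_succ_zero hz, fullFrame_succ, D.leviL_W_left hz]
    simp only [uForm, Fin.cases_succ, add_apply, neg_apply, smul_apply, sum_apply, smul_eq_mul,
      del_eq_delG, conjForm_apply]
    have e : ∑ γ : Fin n, Complex.I * f z / (1 - r z * f z) *
          lowerTorsion f W (torsion ξ W θ) β γ z * θ γ.succ z v =
        f z * ∑ γ : Fin n, Complex.I / (1 - r z * f z) *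
          lowerTorsion f W (torsion ξ W θ) β γ z * θ γ.succ z v := by
      rw [Finset.mul_sum]
      exact Finset.sum_congr rfl fun _ _ => by ring
    rw [e]
    ring

lemma smooth_uForm (i : Fin (n + 1)) :
    ContDiffAt ℝ ∞ (uForm f r W θ (torsion ξ W θ) i) z := by
  have hp := contDiffAt_delG (contDiffAt_toC (D.smooth z hz))
  have hr := contDiffAt_delG (contDiffAt_toC (D.smooth_curv z hz))
  have hc := D.smooth_one_div hz
  refine Fin.cases ?_ (fun β => ?_) i
  · have h := (((D.smooth_ofReal_curv hz).pow 2).mul hc).smul hp |>.add (hc.smul hr)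
    refine h.congr_of_eventuallyEq (.of_forall fun y => ?_)
    simp only [uForm, Fin.cases_zero, del_eq_delG, Pi.smul_apply', mul_one_div]
  · have hA (γ : Fin n) : ContDiffAt ℝ ∞ (lowerTorsion f W (torsion ξ W θ) β γ) z :=
      ContDiffAt.sum fun α _ => (D.smooth_leviMatrix hz β α).mul
        ((Complex.conjCLE : ℂ →L[ℝ] ℂ).contDiff.contDiffAt.comp z (D.smooth_torsion hz α γ))
    have h1 : ContDiffAt ℝ ∞ (fun y => ∑ γ : Fin n, (Complex.I * (1 / (1 - r y * f y : ℂ)) *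
        lowerTorsion f W (torsion ξ W θ) β γ y) • θ γ.succ y) z :=
      ContDiffAt.sum fun γ _ => ((contDiffAt_const.mul hc).mul (hA γ)).smul
        (D.smooth_coframe hz _)
    have h2 : ContDiffAt ℝ ∞ (fun y => (lowerGrad r W β y * (1 / (1 - r y * f y : ℂ))) •
        delG (toC f) y) z := ((hr.clm_apply (D.smooth_W hz β)).mul hc).smul hp
    refine (h1.neg.add h2).congr_of_eventuallyEq (.of_forall fun y => ?_)
    simp only [uForm, Fin.cases_succ, del_eq_delG, mul_one_div]

lemma eventually_neg (h0 : f z < 0) : ∀ᶠ y in nhds z, y ∈ U ∧ f y < 0 :=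
  (D.eventually_mem hz).and ((D.smooth z hz).continuousAt.eventually (gt_mem_nhds h0))

lemma Kform_apply (hG : ∀ a b, G z a b = logMetric f z (coordVec a) (coordVec b))
    (i j : Fin (n + 1)) (u v : Cn n) :
    Kform G (fullFrame ξ W) θ i j z u v =
      kron i j * (logMetric f z u v - logMetric f z v u)
      + (θ j z u * logMetric f z (fullFrame ξ W i z) v
        - θ j z v * logMetric f z (fullFrame ξ W i z) u) := by
  have hf := D.smooth z hz
  have hfm (k l : Fin (n + 1)) : frameMetric G (fullFrame ξ W) k l z =
      logMetric f z (fullFrame ξ W k z) (fullFrame ξ W l z) := by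
    rw [← sum_sum_coord (Q := logMetric f z) (logMetric_smul_left) (logMetric_smul_right hf)]
    simp only [frameMetric, hG]
    exact Finset.sum_congr rfl fun _ _ => Finset.sum_congr rfl fun _ _ => by ring
  have hr (x w : Cn n) : ∑ l, logMetric f z x (fullFrame ξ W l z) * conj (θ l z w) =
      logMetric f z x w := by
    conv_rhs => rw [← D.sum_frame hz w]
    simp only [map_sum, logMetric_smul_right hf]
    exact Finset.sum_congr rfl fun _ _ => mul_comm _ _
  have hl (x w : Cn n) : ∑ k, θ k z w * logMetric f z (fullFrame ξ W k z) x =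
      logMetric f z w x := by
    conv_rhs => rw [← D.sum_frame hz w]
    simp only [map_sum, sum_apply, logMetric_smul_left]
  have e (k : Fin (n + 1)) : ∑ l, (kron i j * frameMetric G (fullFrame ξ W) k l z
        + kron k j * frameMetric G (fullFrame ξ W) i l z) *
        (θ k z u * conj (θ l z v) - conj (θ l z u) * θ k z v) =
      kron i j * (θ k z u * logMetric f z (fullFrame ξ W k z) v
        - θ k z v * logMetric f z (fullFrame ξ W k z) u)
      + (θ k z u * logMetric f z (fullFrame ξ W i z) v
        - θ k z v * logMetric f z (fullFrame ξ W i z) u) * kron k j := by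
    rw [← hr _ v, ← hr _ u, ← hr _ v, ← hr _ u]
    simp only [hfm, Finset.mul_sum, Finset.sum_mul, ← Finset.sum_sub_distrib,
      ← Finset.sum_add_distrib]
    exact Finset.sum_congr rfl fun _ _ => by ring
  simp only [Kform, sum_apply, smul_apply, smul_eq_mul, wedge_apply, conjForm_apply, e]
  rw [Finset.sum_add_distrib, sum_mul_kron, ← Finset.mul_sum, Finset.sum_sub_distrib, hl, hl]

end IsLocalFrame

/-- The pole part of the connection of the metric, as in `Yform_eq`. -/
def poleForm (f : Cn n → ℝ) (θ : Fin (n + 1) → Cn n → OneCovector n) (i j : Fin (n + 1))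
    (z : Cn n) : OneCovector n :=
  negInv f z • ((kron i j : ℂ) • delG (toC f) z + (kron i 0 : ℂ) • θ j z)

lemma poleForm_apply (f : Cn n → ℝ) (θ : Fin (n + 1) → Cn n → OneCovector n) (i j : Fin (n + 1))
    (z v : Cn n) : poleForm f θ i j z v =
      negInv f z * (kron i j * delG (toC f) z v + kron i 0 * θ j z v) := rfl

namespace IsLocalFrame

variable {f : Cn n → ℝ} {U : Set (Cn n)} {ξ : Cn n → Cn n} {r : Cn n → ℝ}
  {W : Fin n → Cn n → Cn n} {θ : Fin (n + 1) → Cn n → OneCovector n} {z : Cn n}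
  {G : Cn n → Matrix (Fin (n + 1)) (Fin (n + 1)) ℂ}

variable (D : IsLocalFrame f U ξ r W θ) (hz : z ∈ U)
include D hz

lemma differentiableAt_poleForm (h0 : f z < 0) (i j : Fin (n + 1)) :
    DifferentiableAt ℝ (poleForm f θ i j) z :=
  (differentiableAt_of_smooth (contDiffAt_negInv (D.smooth z hz) h0.ne)).fun_smul
    (((differentiableAt_of_smooth (contDiffAt_delG (contDiffAt_toC
      (D.smooth z hz)))).fun_const_smul _).fun_add
      ((differentiableAt_of_smooth (D.smooth_coframe hz j)).fun_const_smul _))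

lemma extd_poleForm (h0 : f z < 0) (i j : Fin (n + 1)) (u v : Cn n) :
    extd (poleForm f θ i j) z u v =
      negInv f z * negInv f z * (fderiv ℝ (toC f) z u *
          (kron i j * delG (toC f) z v + kron i 0 * θ j z v)
        - fderiv ℝ (toC f) z v * (kron i j * delG (toC f) z u + kron i 0 * θ j z u))
      + negInv f z * (kron i j * (leviL f z v u - leviL f z u v)
        + kron i 0 * extd (θ j) z u v) := by
  have hf := D.smooth z hz
  have hp := differentiableAt_of_smooth (contDiffAt_delG (contDiffAt_toC hf))
  have hθ := differentiableAt_of_smooth (D.smooth_coframe hz j)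
  have hs := differentiableAt_of_smooth (contDiffAt_negInv hf h0.ne)
  have h1 : DifferentiableAt ℝ (fun y => (kron i j : ℂ) • delG (toC f) y) z := hp.fun_const_smul _
  have h2 : DifferentiableAt ℝ (fun y => (kron i 0 : ℂ) • θ j y) z := hθ.fun_const_smul _
  have e : poleForm f θ i j = fun y =>
      negInv f y • ((kron i j : ℂ) • delG (toC f) y + (kron i 0 : ℂ) • θ j y) := rfl
  rw [e, extd_smul hs (h1.fun_add h2), extd_add h1 h2, extd_const_smul hp, extd_const_smul hθ]
  simp only [add_apply, smul_apply, smul_eq_mul, extd_del hf, fderiv_negInv hf h0.ne]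
  ring

/-- The renormalized curvature: the singular terms of the curvature of the metric are those of `K`,
up to the wedge product with the forms `u`. -/
lemma renCurv_eq_smooth (h0 : f z < 0)
    (hG : ∀ᶠ y in nhds z, ∀ a b, G y a b = logMetric f y (coordVec a) (coordVec b))
    (i j : Fin (n + 1)) :
    renCurv G (fullFrame ξ W) θ i j z =
      curv (smoothConn f ξ r W θ) i j z
        - wedge (uForm f r W θ (torsion ξ W θ) i z) (θ j z) := by
  have hf := D.smooth z hz
  have hm := negInv_mul h0.ne
  have hpsi (i j : Fin (n + 1)) : psi G (fullFrame ξ W) θ i j =ᶠ[nhds z]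
      fun y => smoothConn f ξ r W θ i j y + poleForm f θ i j y := by
    filter_upwards [D.eventually_neg hz h0, hG.eventually_nhds] with y hy hGy
    rw [D.psi_eq hy.1 hy.2 hGy, D.Yform_eq hy.1, poleForm]
  have hRd (i j) := differentiableAt_of_smooth (D.smooth_smoothConn hz i j)
  ext u v
  rw [renCurv, add_apply, add_apply, curv_congr hpsi,
    curv_add hRd (D.differentiableAt_poleForm hz h0), D.extd_poleForm hz h0,
    D.Kform_apply hz hG.self_of_nhds, sub_apply, sub_apply, wedge_apply]
  -- the sums over the frame
  have s1 (u v : Cn n) : ∑ k, smoothConn f ξ r W θ i k z u * poleForm f θ k j z v =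
      negInv f z * (smoothConn f ξ r W θ i j z u * delG (toC f) z v
        + smoothConn f ξ r W θ i 0 z u * θ j z v) := by
    rw [← sum_mul_kron (fun k => smoothConn f ξ r W θ i k z u) j,
      ← sum_mul_kron (fun k => smoothConn f ξ r W θ i k z u) 0, Finset.sum_mul, Finset.sum_mul,
      ← Finset.sum_add_distrib, Finset.mul_sum]
    exact Finset.sum_congr rfl fun k _ => by rw [poleForm_apply]; ring
  have s2 (u v : Cn n) : ∑ k, poleForm f θ i k z u * smoothConn f ξ r W θ k j z v =
      negInv f z * (delG (toC f) z u * smoothConn f ξ r W θ i j z v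
        + kron i 0 * ∑ k, θ k z u * smoothConn f ξ r W θ k j z v) := by
    rw [← sum_kron_mul (fun k => smoothConn f ξ r W θ k j z v) i, Finset.mul_sum, Finset.mul_sum,
      ← Finset.sum_add_distrib, Finset.mul_sum]
    exact Finset.sum_congr rfl fun k _ => by rw [poleForm_apply]; ring
  have s3 (u v : Cn n) : ∑ k, poleForm f θ i k z u * poleForm f θ k j z v =
      negInv f z * negInv f z * (delG (toC f) z u *
          (kron i j * delG (toC f) z v + kron i 0 * θ j z v)
        + kron i 0 * (θ j z u * delG (toC f) z v + delG (toC f) z u * θ j z v)) := by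
    have e1 := sum_kron_mul (fun k => kron k j * delG (toC f) z v + kron k 0 * θ j z v) i
    have e2 := sum_mul_kron (fun k => θ k z u) j
    have e3 := sum_mul_kron (fun k => θ k z u) 0
    rw [D.coframe_zero hz] at e3
    have e : ∑ k, poleForm f θ i k z u * poleForm f θ k j z v =
        negInv f z * negInv f z * (delG (toC f) z u *
          ∑ k, kron i k * (kron k j * delG (toC f) z v + kron k 0 * θ j z v)
          + kron i 0 * ((∑ k, θ k z u * kron k j) * delG (toC f) z v
            + (∑ k, θ k z u * kron k 0) * θ j z v)) := by
      rw [Finset.sum_mul, Finset.sum_mul, ← Finset.sum_add_distrib, Finset.mul_sum,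
        Finset.mul_sum, ← Finset.sum_add_distrib, Finset.mul_sum]
      exact Finset.sum_congr rfl fun k _ => by rw [poleForm_apply, poleForm_apply]; ring
    rw [e, e1, e2, e3]
  have hθ : extd (θ j) z u v = ∑ k, θ k z u * smoothConn f ξ r W θ k j z v
      - ∑ k, θ k z v * smoothConn f ξ r W θ k j z u := by
    rw [D.extd_coframe hz, ← Finset.sum_sub_distrib]
    simp only [sum_apply, wedge_apply]
    exact Finset.sum_congr rfl fun _ _ => by ring
  have c1 : ∀ k, poleForm f θ k j z u * smoothConn f ξ r W θ i k z v =
      smoothConn f ξ r W θ i k z v * poleForm f θ k j z u := fun k => mul_comm _ _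
  have c2 : ∀ k, smoothConn f ξ r W θ k j z u * poleForm f θ i k z v =
      poleForm f θ i k z v * smoothConn f ξ r W θ k j z u := fun k => mul_comm _ _
  have c3 : ∀ k, poleForm f θ k j z u * poleForm f θ i k z v =
      poleForm f θ i k z v * poleForm f θ k j z u := fun k => mul_comm _ _
  simp only [Finset.sum_sub_distrib, c1, c2, c3, s1, s2, s3, hθ, fderiv_toC_apply,
    logMetric_apply, D.del_frame hz, D.smoothConn_eq_uForm hz]
  linear_combination (uForm f r W θ (torsion ξ W θ) i z u * θ j z v
    - uForm f r W θ (torsion ξ W θ) i z v * θ j z u) * hm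

end IsLocalFrame

/-! ### Charts of the complex manifold -/

section Germ

variable {f f' : Cn n → ℝ} {z : Cn n}

lemma delG_congr (h : f =ᶠ[nhds z] f') : delG (toC f) z = delG (toC f') z := by
  have : toC f =ᶠ[nhds z] toC f' := h.mono fun y hy => by simp [toC, hy]
  simp only [delG, this.fderiv_eq]

lemma leviL_congr (h : f =ᶠ[nhds z] f') : leviL f z = leviL f' z := by
  have : delbarG (toC f) =ᶠ[nhds z] delbarG (toC f') := h.eventuallyEq_nhds.mono fun y hy => by
    have : toC f =ᶠ[nhds y] toC f' := hy.mono fun y hy => by simp [toC, hy]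
    simp only [delbarG, this.fderiv_eq]
  simp only [leviL, delG, this.fderiv_eq]

lemma IsGoodAt.congr (hf : ContDiffAt ℝ ∞ f z) (h : f' =ᶠ[nhds z] f) (hg : IsGoodAt f z) :
    IsGoodAt f' z := by
  have hf' : ContDiffAt ℝ ∞ f' z := hf.congr_of_eventuallyEq h
  have h1 := delG_congr h
  have h2 := leviL_congr h
  refine ⟨⟨h1 ▸ hg.1.1, fun V hV hp => ?_⟩, fun v s e => ?_⟩
  · rw [h2]
    exact hg.1.2 V hV (h1 ▸ hp)
  · rw [h.self_of_nhds]
    refine hg.2 v s ⟨?_, fun V => ?_⟩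
    · have := e.1
      rwa [del_eq_delG, h1] at this
    · have := e.2 V
      rwa [levi_eq hf', h2, ← levi_eq hf, del_eq_delG, h1] at this

end Germ

section Charts

lemma comp_symm_eventuallyEq {Y : Type*} [TopologicalSpace Y]
    {e c : OpenPartialHomeomorph Y (Cn n)} {z : Cn n} (ρ : Y → ℝ) (hz : z ∈ e.target) (hx : e.symm z ∈ c.source) :
    ρ ∘ e.symm =ᶠ[nhds z] (ρ ∘ c.symm) ∘ (c ∘ e.symm) := by
  filter_upwards [(e.symm.continuousAt hz).preimage_mem_nhds (c.open_source.mem_nhds hx)]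
    with y hy
  simp only [Function.comp_apply]
  rw [c.left_inv hy]

variable {Y : Type*} [TopologicalSpace Y] [ChartedSpace (Cn n) Y]
  {e c : OpenPartialHomeomorph Y (Cn n)} {z : Cn n}

lemma contDiffAt_transition (he : e ∈ IsManifold.maximalAtlas 𝓘(ℂ, Cn n) ω Y)
    (hc : c ∈ IsManifold.maximalAtlas 𝓘(ℂ, Cn n) ω Y) (hz : z ∈ e.target)
    (hx : e.symm z ∈ c.source) : ContDiffAt ℂ ω (c ∘ e.symm) z := by
  rw [← contMDiffAt_iff_contDiffAt]
  have h1 := (contMDiffOn_symm_of_mem_maximalAtlas he).contMDiffAt (e.open_target.mem_nhds hz)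
  have h2 := (contMDiffOn_of_mem_maximalAtlas hc).contMDiffAt (c.open_source.mem_nhds hx)
  exact h2.comp z h1

lemma bijective_fderiv_transition (he : e ∈ IsManifold.maximalAtlas 𝓘(ℂ, Cn n) ω Y)
    (hc : c ∈ IsManifold.maximalAtlas 𝓘(ℂ, Cn n) ω Y) (hz : z ∈ e.target)
    (hx : e.symm z ∈ c.source) : Function.Bijective (fderiv ℂ (c ∘ e.symm) z) := by
  have left {e c : OpenPartialHomeomorph Y (Cn n)} {z : Cn n}
      (he : e ∈ IsManifold.maximalAtlas 𝓘(ℂ, Cn n) ω Y)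
      (hc : c ∈ IsManifold.maximalAtlas 𝓘(ℂ, Cn n) ω Y) (hz : z ∈ e.target)
      (hx : e.symm z ∈ c.source) (v : Cn n) :
      fderiv ℂ (e ∘ c.symm) (c (e.symm z)) (fderiv ℂ (c ∘ e.symm) z v) = v := by
    have d1 : DifferentiableAt ℂ (c ∘ e.symm) z :=
      (contDiffAt_transition he hc hz hx).differentiableAt (by simp)
    have d2 : DifferentiableAt ℂ (e ∘ c.symm) ((c ∘ e.symm) z) :=
      (contDiffAt_transition hc he (c.map_source hx)
        (by
          rw [c.left_inv hx]
          exact e.map_target hz)).differentiableAt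
        (by simp)
    have hid : (e ∘ c.symm) ∘ (c ∘ e.symm) =ᶠ[nhds z] id := by
      filter_upwards [e.open_target.mem_nhds hz,
        (e.symm.continuousAt hz).preimage_mem_nhds (c.open_source.mem_nhds hx)] with y hy hy'
      simp only [Function.comp_apply, id]
      rw [c.left_inv hy', e.right_inv hy]
    have h := (fderiv_comp z d2 d1).symm.trans hid.fderiv_eq
    rw [fderiv_id] at h
    exact DFunLike.congr_fun h v
  have hz' : c (e.symm z) ∈ c.target := c.map_source hx
  have hx' : c.symm (c (e.symm z)) ∈ e.source := by
    rw [c.left_inv hx]; exact e.map_target hz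
  have right := left hc he hz' hx'
  rw [c.left_inv hx, e.right_inv hz] at right
  exact ⟨Function.LeftInverse.injective (left he hc hz hx),
    Function.RightInverse.surjective right⟩

variable [IsManifold 𝓘(ℂ, Cn n) ω Y]

lemma contDiffAt_comp_symm {ρ : Y → ℝ} (hρ : ContMDiff 𝓘(ℝ, Cn n) 𝓘(ℝ, ℝ) ∞ ρ)
    (he : e ∈ IsManifold.maximalAtlas 𝓘(ℂ, Cn n) ω Y) (hz : z ∈ e.target) :
    ContDiffAt ℝ ∞ (ρ ∘ e.symm) z := by
  set x := e.symm z with hx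
  have hxs : x ∈ (chartAt (Cn n) x).source := mem_chart_source _ x
  have h1 := (contMDiffAt_iff.1 (hρ x)).2
  simp only [mfld_simps] at h1
  have h1' : ContDiffAt ℝ ∞ (ρ ∘ (chartAt (Cn n) x).symm) ((chartAt (Cn n) x ∘ e.symm) z) := by
    rw [contDiffWithinAt_univ] at h1
    exact h1
  have h2 : ContDiffAt ℝ ∞ (chartAt (Cn n) x ∘ e.symm) z :=
    ((contDiffAt_transition he (IsManifold.chart_mem_maximalAtlas x) hz hxs).restrict_scalars
      ℝ).of_le (by simp)
  exact (h1'.comp z h2).congr_of_eventuallyEq (comp_symm_eventuallyEq ρ hz hxs)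

lemma eventually_contDiffAt_comp_symm {ρ : Y → ℝ} (hρ : ContMDiff 𝓘(ℝ, Cn n) 𝓘(ℝ, ℝ) ∞ ρ)
    (he : e ∈ IsManifold.maximalAtlas 𝓘(ℂ, Cn n) ω Y) (hz : z ∈ e.target) :
    ∀ᶠ y in nhds z, ContDiffAt ℝ ∞ (ρ ∘ e.symm) y :=
  Filter.mem_of_superset (e.open_target.mem_nhds hz) fun _ hy => contDiffAt_comp_symm hρ he hy

/-- The condition `IsGoodAt` is independent of the chart. -/
lemma isGoodAt_of_chart {ρ : Y → ℝ} (hρ : ContMDiff 𝓘(ℝ, Cn n) 𝓘(ℝ, ℝ) ∞ ρ)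
    (he : e ∈ IsManifold.maximalAtlas 𝓘(ℂ, Cn n) ω Y)
    (hc : c ∈ IsManifold.maximalAtlas 𝓘(ℂ, Cn n) ω Y) (hz : z ∈ e.target)
    (hx : e.symm z ∈ c.source) (h : IsGoodAt (ρ ∘ c.symm) (c (e.symm z))) :
    IsGoodAt (ρ ∘ e.symm) z := by
  have hev := eventually_contDiffAt_comp_symm hρ hc (c.map_source hx)
  have hτ := contDiffAt_transition he hc hz hx
  have h1 : IsGoodAt ((ρ ∘ c.symm) ∘ (c ∘ e.symm)) z :=
    isGoodAt_comp_holomorphic hτ hev (bijective_fderiv_transition he hc hz hx) h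
  refine h1.congr ?_ (comp_symm_eventuallyEq ρ hz hx)
  exact (hev.self_of_nhds).comp z ((hτ.restrict_scalars ℝ).of_le (by simp))

/-- The neighbourhood of the boundary on which all constructions take place: the interior of the set
of points of `N` satisfying `IsGoodAt`. -/
def goodNhd (n : ℕ) {Y : Type*} [TopologicalSpace Y] [ChartedSpace (Cn n) Y] (ρ : Y → ℝ)
    (N : Set Y) : Set Y :=
  interior {x | x ∈ N ∧ IsGoodAt (ρ ∘ (chartAt (Cn n) x).symm) (chartAt (Cn n) x x)}

lemma boundary_subset_goodNhd {ρ : Y → ℝ} (hρ : IsStrictlyPseudoconvexDefiningFunction (n := n) ρ)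
    {N : Set Y} (hN : IsOpen N) (hMN : {x | ρ x = 0} ⊆ N) :
    {x | ρ x = 0} ⊆ goodNhd n ρ N := by
  intro x hx
  rw [goodNhd, mem_interior_iff_mem_nhds]
  set c := chartAt (Cn n) x with hc
  have hcA : c ∈ IsManifold.maximalAtlas 𝓘(ℂ, Cn n) ω Y := IsManifold.chart_mem_maximalAtlas x
  have hxs : x ∈ c.source := mem_chart_source _ x
  have hz : c x ∈ c.target := c.map_source hxs
  have h0 : ρ (c.symm (c x)) = 0 := by rw [c.left_inv hxs]; exact hx
  have hev := eventually_contDiffAt_comp_symm hρ.smooth hcA hz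
  have hf := hev.self_of_nhds
  have hs : IsStrictAt (ρ ∘ c.symm) (c x) := by
    refine ⟨fun hd => hρ.regular c hcA _ hz h0 (ContinuousLinearMap.ext fun v => ?_),
      fun V hV hp => ?_⟩
    · have h1 : fderiv ℝ (toC (ρ ∘ c.symm)) (c x) v = (fderiv ℝ (ρ ∘ c.symm) (c x) v : ℂ) := by
        have : toC (ρ ∘ c.symm) = Complex.ofRealCLM ∘ (ρ ∘ c.symm) := rfl
        rw [this, fderiv_comp (c x) (Complex.ofRealCLM.differentiableAt)
          (differentiableAt_of_smooth hf), Complex.ofRealCLM.fderiv]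
        rfl
      rw [fderiv_toC_apply, hd] at h1
      simpa using h1.symm
    · rw [← levi_eq hf]
      exact hρ.pseudoconvex c hcA _ hz h0 V hV hp
  have hgood := (c.continuousAt hxs).eventually (eventually_isGoodAt hev hs h0)
  filter_upwards [hgood, hN.mem_nhds (hMN hx), c.open_source.mem_nhds hxs] with y hy hyN hyc
  refine ⟨hyN, ?_⟩
  have hyy := mem_chart_source (Cn n) y
  refine isGoodAt_of_chart hρ.smooth (IsManifold.chart_mem_maximalAtlas y) hcA
    ((chartAt (Cn n) y).map_source hyy) ?_ ?_
  · rwa [(chartAt (Cn n) y).left_inv hyy]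
  · rwa [(chartAt (Cn n) y).left_inv hyy]

lemma isGoodAt_of_mem_goodNhd {ρ : Y → ℝ} (hρ : ContMDiff 𝓘(ℝ, Cn n) 𝓘(ℝ, ℝ) ∞ ρ) {N : Set Y}
    (he : e ∈ IsManifold.maximalAtlas 𝓘(ℂ, Cn n) ω Y) (hz : z ∈ e.target)
    (hx : e.symm z ∈ goodNhd n ρ N) : e.symm z ∈ N ∧ IsGoodAt (ρ ∘ e.symm) z := by
  have h := interior_subset hx
  exact ⟨h.1, isGoodAt_of_chart hρ he (IsManifold.chart_mem_maximalAtlas _) hz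
    (mem_chart_source _ _) h.2⟩

end Charts

/-- A form that agrees on the side `f < 0` with a form smooth on `U` is continuous up to the
boundary. -/
lemma continuousUpToBoundary_of_smooth {B : Type*} [NormedAddCommGroup B] [NormedSpace ℝ B]
    {f : Cn n → ℝ} {U : Set (Cn n)} {α β : Cn n → B} (hβ : ∀ z ∈ U, ContDiffAt ℝ ∞ β z)
    (h : ∀ z ∈ U, f z < 0 → α z = β z) : ContinuousUpToBoundary f U α :=
  ⟨β, fun z hz => (hβ z hz.1).continuousAt.continuousWithinAt, fun z hz h0 => (h z hz h0).symm⟩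

end BurnsEpstein
end

open BurnsEpstein
theorem mainTheorem5 (n : ℕ) {Y : Type*} [TopologicalSpace Y] [T2Space Y]
    [SecondCountableTopology Y] [ChartedSpace (Cn n) Y]
    [IsManifold 𝓘(ℂ, Cn n) ω Y]
    (ρ : Y → ℝ) (hρ : IsStrictlyPseudoconvexDefiningFunction (n := n) ρ)
    (g : ∀ x : Y, TangentSpace 𝓘(ℂ, Cn n) x →
      TangentSpace 𝓘(ℂ, Cn n) x → ℂ)
    (hg : IsHermitianMetricOn g {x | ρ x < 0})
    (hgρ : IsLogMetricNearBoundary ρ g) :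
    ∃ V : Set Y, IsOpen V ∧ {x | ρ x = 0} ⊆ V ∧
      ∀ e ∈ IsManifold.maximalAtlas 𝓘(ℂ, Cn n) ω Y,
      ∀ f : Cn n → ℝ, f = ρ ∘ e.symm →
      ∀ G : Cn n → Matrix (Fin (n + 1)) (Fin (n + 1)) ℂ,
        G = metricCoeff g e →
      ∃ (ξ : Cn n → Cn n) (r : Cn n → ℝ),
        IsTransverse f (e.target ∩ e.symm ⁻¹' V) ξ r ∧
        (∀ z ∈ e.target ∩ e.symm ⁻¹' V, 0 < 1 - r z * f z) ∧
        ∀ U : Set (Cn n), IsOpen U → U ⊆ e.target ∩ e.symm ⁻¹' V →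
        ∀ (W : Fin n → Cn n → Cn n)
          (θ : Fin (n + 1) → Cn n → OneCovector n),
          IsAdmissible f U ξ W θ →
          ∀ F : Fin (n + 1) → Cn n → Cn n,
            F = fullFrame ξ W →
          (∀ z ∈ U, (leviMatrix f W z).PosDef) ∧
          ∃ (φ : Fin n → Fin n → Cn n → OneCovector n)
            (A : Fin n → Fin n → Cn n → ℂ),
            -- the Graham–Lee connection and its torsion: existence and uniqueness
            IsGrahamLee f U r W θ φ A ∧
            (∀ φ' A', IsGrahamLee f U r W θ φ' A' →
              ∀ z ∈ U, ∀ α β, φ' α β z = φ α β z ∧ A' α β z = A α β z) ∧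
            -- the renormalized connection
            (∀ z ∈ U, f z < 0 →
              (∀ β α : Fin n, renConn f G F θ β.succ α.succ z =
                φ β α z + (Complex.I * r z * kron β α) •
                  contactForm f z) ∧
              (∀ α : Fin n, renConn f G F θ 0 α.succ z =
                (r z : ℂ) • θ α.succ z
                - ∑ γ : Fin n, (Complex.I * A α γ z) • conjForm (θ γ.succ z)
                - upperGrad f r W α z •
                    delbar (toC f) z) ∧
              (∀ β : Fin n, renConn f G F θ β.succ 0 z =
                -(∑ γ : Fin n, leviMatrix f W z β γ •
                    conjForm (θ γ.succ z))
                + (-(f z : ℂ) * lowerGrad r W β z / (1 - r z * f z)) •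
                    del (toC f) z
                + ∑ γ : Fin n, (Complex.I * f z / (1 - r z * f z) *
                    lowerTorsion f W A β γ z) • θ γ.succ z) ∧
              renConn f G F θ 0 0 z =
                -((r z : ℂ) • delbar (toC f) z)
                + (-(f z : ℂ) * (r z : ℂ) ^ 2 / (1 - r z * f z)) •
                    del (toC f) z
                + (-(f z : ℂ) / (1 - r z * f z)) •
                    del (toC r) z) ∧
            -- the renormalized curvature
            (∀ z ∈ U, f z < 0 → ∀ i j : Fin (n + 1),
              renCurv G F θ i j z =
                curv (renConn f G F θ) i j z
                - wedge (uForm f r W θ A i z) (θ j z)) ∧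
            -- continuity up to the boundary
            (∀ i j : Fin (n + 1),
              ContinuousUpToBoundary f U (renConn f G F θ i j) ∧
              ContinuousUpToBoundary f U
                (curv (renConn f G F θ) i j) ∧
              ContinuousUpToBoundary f U (renCurv G F θ i j) ∧
              ContinuousUpToBoundary f U
                (uForm f r W θ A i)) := by
  obtain ⟨N, hN, hMN, hlog⟩ := hgρ
  refine ⟨goodNhd n ρ N, isOpen_interior, boundary_subset_goodNhd hρ hN hMN, ?_⟩
  rintro e he f rfl G rfl
  set f := ρ ∘ e.symm with hf
  set S := e.target ∩ e.symm ⁻¹' goodNhd n ρ N with hS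
  have hsm : ∀ z ∈ S, ContDiffAt ℝ ∞ f z := fun z hz => contDiffAt_comp_symm hρ.smooth he hz.1
  have hgood : ∀ z ∈ S, e.symm z ∈ N ∧ IsGoodAt f z := fun z hz =>
    isGoodAt_of_mem_goodNhd hρ.smooth he hz.1 hz.2
  have htr : ∀ z ∈ S, IsTransverseAt f z (transField f z) (transCurv f z) := fun z hz =>
    isTransverseAt_transField (hsm z hz) (hgood z hz).2.1
  have hpos : ∀ z ∈ S, 0 < 1 - transCurv f z * f z := fun z hz => (hgood z hz).2.2 _ _ (htr z hz)
  refine ⟨transField f, transCurv f, ⟨fun z hz =>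
      (contDiffAt_transField (hsm z hz) (hgood z hz).2.1).contDiffWithinAt, fun z hz =>
      (contDiffAt_transCurv (hsm z hz) (hgood z hz).2.1).contDiffWithinAt, htr,
      fun z hz v s h => isTransverseAt_unique (hsm z hz) (hgood z hz).2.1 h⟩, hpos, ?_⟩
  rintro U hU hUS W θ hadm F rfl
  have D : IsLocalFrame f U (transField f) (transCurv f) W θ :=
    { isOpen := hU
      smooth := fun z hz => hsm z (hUS hz)
      strict := fun z hz => (hgood z (hUS hz)).2.1
      smooth_field := fun z hz => contDiffAt_transField (hsm z (hUS hz)) (hgood z (hUS hz)).2.1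
      smooth_curv := fun z hz => contDiffAt_transCurv (hsm z (hUS hz)) (hgood z (hUS hz)).2.1
      eqns := fun z hz => htr z (hUS hz)
      pos := fun z hz => hpos z (hUS hz)
      admissible := hadm }
  have hG : ∀ z ∈ U, f z < 0 → ∀ᶠ y in nhds z, ∀ a b,
      metricCoeff g e y a b = logMetric f y (coordVec a) (coordVec b) := fun z hz h0 => by
    filter_upwards [D.eventually_neg hz h0] with y hy a b
    rw [hlog e he y (hUS hy.1).1 (hgood y (hUS hy.1)).1 hy.2,
      ← levi_log (D.eventually_smooth hy.1) hy.2.ne]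
    rfl
  have hconn (i j) : ∀ z ∈ U, f z < 0 → renConn f (metricCoeff g e) (fullFrame (transField f) W)
      θ i j z = smoothConn f (transField f) (transCurv f) W θ i j z := fun z hz h0 =>
    D.renConn_eq hz h0 (hG z hz h0) i j
  have hcurv (i j) : ∀ z ∈ U, f z < 0 →
      curv (renConn f (metricCoeff g e) (fullFrame (transField f) W) θ) i j z =
        curv (smoothConn f (transField f) (transCurv f) W θ) i j z := fun z hz h0 =>
    curv_congr (fun i j => (D.eventually_neg hz h0).mono fun y hy => hconn i j y hy.1 hy.2) i j
  have hren (i j) : ∀ z ∈ U, f z < 0 →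
      renCurv (metricCoeff g e) (fullFrame (transField f) W) θ i j z =
        curv (smoothConn f (transField f) (transCurv f) W θ) i j z
          - wedge (uForm f (transCurv f) W θ (torsion (transField f) W θ) i z) (θ j z) :=
    fun z hz h0 => D.renCurv_eq_smooth hz h0 (hG z hz h0) i j
  refine ⟨fun z hz => D.posDef hz, grahamLee f (transField f) (transCurv f) W θ,
    torsion (transField f) W θ, D.isGrahamLee,
    fun φ' A' h z hz α β => D.isGrahamLee_unique hz D.isGrahamLee h α β, ?_, ?_, ?_⟩
  · intro z hz h0
    simp only [hconn _ _ z hz h0, del_eq_delG, delbar_eq_delbarG]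
    exact ⟨fun β α => smoothConn_succ_succ _ _ _ _ _ _ _ _, D.smoothConn_zero_succ hz,
      D.smoothConn_succ_zero hz, D.smoothConn_zero_zero hz⟩
  · intro z hz h0 i j
    rw [hren i j z hz h0, hcurv i j z hz h0]
  · intro i j
    have hc : ∀ z ∈ U, ContDiffAt ℝ ∞
        (curv (smoothConn f (transField f) (transCurv f) W θ) i j) z := fun z hz =>
      contDiffAt_curv (D.smooth_smoothConn hz) i j
    exact ⟨continuousUpToBoundary_of_smooth (fun z hz => D.smooth_smoothConn hz i j) (hconn i j),
      continuousUpToBoundary_of_smooth hc (hcurv i j),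
      continuousUpToBoundary_of_smooth (fun z hz => (hc z hz).sub
        (contDiffAt_wedge (D.smooth_uForm hz i) (D.smooth_coframe hz j))) (hren i j),
      continuousUpToBoundary_of_smooth (fun z hz => D.smooth_uForm hz i) fun _ _ _ => rfl⟩
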